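/- For $0<\beta<\alpha<1$ let $T_{\alpha,\beta}\colon[0,1)\to[0,1)$ be the Bruin--Troubetzkoy interval translation mapping $$T_{\alpha,\beta}(x)=\begin{cases}x+\alpha,& x\in[0,1-\alpha),\\ x+\beta,& x\in[1-\alpha,1-\beta),\\ x+\beta-1,& x\in[1-\beta,1).\end{cases}$$ It is of infinite type if the decreasing sequence of sets $\Omega_n=\bigcap_{j=0}^{n}T_{\alpha,\beta}^j[0,1)$ does not stabilize. Let $$\mathcal R(\alpha,\beta)=\begin{cases}\left(\frac{\alpha}{1-\alpha},\frac{\beta}{1-\alpha}\right),&\alpha\le \frac12,\\[2pt] \left(\frac{\beta}{\alpha},\frac{\alpha+\beta-1}{\alpha}\right),&\alpha>\frac12,\end{cases}\qquad r(\alpha,\beta)=\begin{cases}-\log(1-\alpha),&\alpha\le\frac12,\\ -\log\alpha,&\alpha>\frac12,\end{cases}$$ be the Rauzy-type induction on the parameters and its roof function. Let $\mathcal G(\alpha,\beta)=\mathcal R^{\lfloor 1/\alpha\rfloor}(\alpha,\beta)$ be its acceleration. The digits of $(\alpha,\beta)$ are $k_i=\lfloor 1/\alpha_i\rfloor$, $i\ge1$,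 where $(\alpha_i,\beta_i)=\mathcal G^{i-1}(\alpha,\beta)$. Let $\mu$ be the natural measure on the parameters of infinite type, that is, an $\mathcal R$-invariant Borel probability measure which gives full measure to the parameters of infinite type and is the Gibbs measure of a potential $-\kappa r$ of pressure zero, in the following sense: for some $\kappa\in\mathbb R$, $\mu$ is absolutely continuous with respect to a Borel probability measure $\nu$ on $\Delta=\{0<\beta<\alpha<1\}$ such that $$\int_\Delta\ \sum_{p\in\Delta,\ \mathcal R(p)=q}e^{-\kappa r(p)}f(p)\,d\nu(q)=\int_\Delta f\,d\nu\qquad\text{for every Borel } f\ge0.$$ For $k\ge1$ put $$A_3(k)=\begin{pmatrix}0&k&k-1\\1&0&0\\0&1&1\end{pmatrix},\qquad B_3(k)=\begin{pmatrix}0&1&0\\1&0&1\\k-1&0&k\end{pmatrix}.$$ The Lyapunov exponents $\lambda_1\ge\lambda_2\ge\lambda_3$ of a product $M(k_1)M(k_2)\cdots M(k_n)$ of $3\times3$ matrices are the limits, if they exist, of $\frac1n\log\sigma_i\bigl(M(k_1)\cdots M(k_n)\bigr)$ as $n\to\infty$, where $\sigma_1\ge\sigma_2\ge\sigma_3$ are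 the singular values. Theorem. For $\mu$-almost every parameter whose digits satisfy $k_{2i}>1$ for infinitely many $i$ and $k_{2j+1}>1$ for infinitely many $j$, the Lyapunov exponents of $A_3(k_1)\cdots A_3(k_n)$ and of $B_3(k_1)\cdots B_3(k_n)$ exist, the product $A_3(k_1)\cdots A_3(k_n)$ has two positive and one negative Lyapunov exponent, $$\lambda_1(A_3)\ge\lambda_2(A_3)>0>\lambda_3(A_3),$$ and $\lambda_1(B_3)>\lambda_1(A_3)$. -/

import Mathlib

open MeasureTheory Filter Topology
open scoped ENNReal

noncomputable section

/-! ### Bruin-Troubetzkoy interval translation mappings -/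

/-- The open triangle of parameters `(α, β)` with `1 > α > β > 0`. -/
def btTriangle : Set (ℝ × ℝ) := {p | 0 < p.2 ∧ p.2 < p.1 ∧ p.1 < 1}

/-- The Bruin-Troubetzkoy map with parameters `p = (α, β)`; it is used on `[0, 1)` only. -/
def btMap (p : ℝ × ℝ) (x : ℝ) : ℝ :=
  if x < 1 - p.1 then x + p.1
  else if x < 1 - p.2 then x + p.2
  else x + p.2 - 1

/-- The level `n` attractor `I ∩ T I ∩ ⋯ ∩ Tⁿ I` of `T`, where `I = [0, 1)`. -/
def attractor (T : ℝ → ℝ) (n : ℕ) : Set ℝ := ⋂ j ∈ Finset.range (n + 1), T^[j] '' Set.Ico 0 1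

/-- `T` is of finite type if its sequence of attractors stabilizes. -/
def IsFiniteType (T : ℝ → ℝ) : Prop := ∃ N, ∀ n, N ≤ n → attractor T n = attractor T (n + 1)

/-- The parameters (inside the triangle) of the Bruin-Troubetzkoy maps of infinite type. -/
def btInfiniteType : Set (ℝ × ℝ) := {p | p ∈ btTriangle ∧ ¬ IsFiniteType (btMap p)}

/-! ### The induction, its acceleration and the digits -/

/-- The Rauzy-type induction on parameters. The three intervals of continuity have lengths
`(l₁, l₂, l₃) = (1 - α, α - β, β)`. If `l₁ ≥ l₂ + l₃`, one induces on `[l₂ + l₃, 1)` and the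
lengths become `(l₁ - l₂ - l₃, l₂, l₃)`. Otherwise one induces on `[l₁, 1)` and the lengths become
`(l₂, l₁, l₃ - l₁)`. In both cases the new interval is rescaled to `[0, 1)`. -/
def btInduction (p : ℝ × ℝ) : ℝ × ℝ :=
  if p.1 ≤ 1 / 2 then (p.1 / (1 - p.1), p.2 / (1 - p.1))
  else (p.2 / p.1, (p.1 + p.2 - 1) / p.1)

/-- The roof function of the natural suspension flow over the induction: minus the logarithm of
the length of the interval on which one induces. -/
def btRoof (p : ℝ × ℝ) : ℝ :=
  if p.1 ≤ 1 / 2 then -Real.log (1 - p.1) else -Real.log p.1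

/-- The acceleration of the induction: with `k = ⌊1 / α⌋`, the first case `k - 1` times, then the
second case once. -/
def btGauss (p : ℝ × ℝ) : ℝ × ℝ := btInduction^[⌊1 / p.1⌋₊] p

/-- The sequence of digits of a parameter; `btDigit p n` is the digit `k_{n+1}`. -/
def btDigit (p : ℝ × ℝ) (n : ℕ) : ℕ := ⌊1 / (btGauss^[n] p).1⌋₊

/-! ### The natural measure -/

/-- The inverse branch of the first case of the induction. -/
def btBranchA (q : ℝ × ℝ) : ℝ × ℝ := (q.1 / (1 + q.1), q.2 / (1 + q.1))

/-- The inverse branch of the second case of the induction. -/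
def btBranchC (q : ℝ × ℝ) : ℝ × ℝ := (1 / (1 + q.1 - q.2), q.1 / (1 + q.1 - q.2))

theorem btBranchA_mem {q : ℝ × ℝ} (hq : q ∈ btTriangle) :
    btBranchA q ∈ btTriangle ∧ btInduction (btBranchA q) = q := by
  obtain ⟨h1, h2, h3⟩ := hq
  have h0 : (0 : ℝ) < 1 + q.1 := by linarith
  have hle : q.1 / (1 + q.1) ≤ 1 / 2 := by rw [div_le_div_iff₀ h0 two_pos]; linarith
  have hs : 1 - q.1 / (1 + q.1) = 1 / (1 + q.1) := by field_simp; ring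
  refine ⟨⟨div_pos h1 h0, div_lt_div_of_pos_right h2 h0, ?_⟩, ?_⟩
  · simp only [btBranchA]; linarith
  · simp only [btInduction, btBranchA, if_pos hle, hs]
    ext <;> simp <;> field_simp

theorem btBranchC_mem {q : ℝ × ℝ} (hq : q ∈ btTriangle) :
    btBranchC q ∈ btTriangle ∧ btInduction (btBranchC q) = q := by
  obtain ⟨h1, h2, h3⟩ := hq
  have h0 : (0 : ℝ) < 1 + q.1 - q.2 := by linarith
  have hle : ¬ 1 / (1 + q.1 - q.2) ≤ 1 / 2 := by
    rw [div_le_div_iff₀ h0 two_pos]; linarith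
  refine ⟨⟨div_pos (by linarith) h0, div_lt_div_of_pos_right h3 h0, ?_⟩, ?_⟩
  · simp only [btBranchC]; rw [div_lt_one h0]; linarith
  · have h : btInduction (btBranchC q) = (_, _) := if_neg hle
    rw [h]
    ext <;> simp only [btBranchC] <;> field_simp
    ring

/-- The two branches are all the preimages under the induction inside the triangle. -/
theorem eq_btBranch {p q : ℝ × ℝ} (hp : p ∈ btTriangle) (h : btInduction p = q) :
    p = btBranchA q ∨ p = btBranchC q := by
  obtain ⟨h1, h2, h3⟩ := hp
  have ha : (0 : ℝ) < p.1 := by linarith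
  have hb : (1 : ℝ) - p.1 ≠ 0 := by linarith
  subst h
  by_cases hc : p.1 ≤ 1 / 2
  · left
    have hs : 1 + p.1 / (1 - p.1) = 1 / (1 - p.1) := by field_simp; ring
    simp only [btInduction, btBranchA, if_pos hc, hs]
    ext <;> simp <;> field_simp
  · right
    have hs : 1 + p.2 / p.1 - (p.1 + p.2 - 1) / p.1 = 1 / p.1 := by field_simp; ring
    simp only [btInduction, btBranchC, if_neg hc, hs]
    ext <;> simp
    field_simp

/-- The Ruelle transfer operator of the induction with potential `-κ r`, `r` the roof function:
`(L f)(q) = ∑ exp (-κ r(p)) f(p)`, the sum over the two preimages `p` of `q`. -/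
def btTransfer (κ : ℝ) (f : ℝ × ℝ → ℝ≥0∞) (q : ℝ × ℝ) : ℝ≥0∞ :=
  ENNReal.ofReal (Real.exp (-κ * btRoof (btBranchA q))) * f (btBranchA q) +
    ENNReal.ofReal (Real.exp (-κ * btRoof (btBranchC q))) * f (btBranchC q)

/-- `ν` is a conformal probability measure for the potential `-κ r` at pressure zero: it is fixed
by the dual of the transfer operator. -/
structure IsBTConformal (κ : ℝ) (ν : Measure (ℝ × ℝ)) : Prop where
  isProbabilityMeasure : IsProbabilityMeasure ν
  compl_null : ν btTriangleᶜ = 0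
  lintegral_transfer : ∀ f : ℝ × ℝ → ℝ≥0∞, Measurable f →
    ∫⁻ q, btTransfer κ f q ∂ν = ∫⁻ p, f p ∂ν

/-- The natural measure: the probability measure carried by the parameters of infinite type which
is invariant under the induction and is the Gibbs measure of a potential `-κ r` of pressure zero,
`r` the roof function, that is, absolutely continuous with respect to a conformal measure. -/
structure IsBTMeasure (μ : Measure (ℝ × ℝ)) : Prop where
  isProbabilityMeasure : IsProbabilityMeasure μ
  ae_infiniteType : ∀ᵐ p ∂μ, p ∈ btInfiniteType
  invariant : MeasurePreserving btInduction μ μ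
  gibbs : ∃ (κ : ℝ) (ν : Measure (ℝ × ℝ)), IsBTConformal κ ν ∧ μ ≪ ν

/-! ### Matrices and Lyapunov exponents -/

/-- The incidence matrix of the substitution `1 ↦ 2, 2 ↦ 31ᵏ, 3 ↦ 31ᵏ⁻¹`. -/
def A₃ (k : ℕ) : Matrix (Fin 3) (Fin 3) ℝ :=
  !![0, (k : ℝ), (k : ℝ) - 1; 1, 0, 0; 0, 1, 1]

/-- The matrix `B₃(k)`. -/
def B₃ (k : ℕ) : Matrix (Fin 3) (Fin 3) ℝ :=
  !![0, 1, 0; 1, 0, 1; (k : ℝ) - 1, 0, (k : ℝ)]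

/-- The product `M(k₁) M(k₂) ⋯ M(kₙ)`, where `k i` stands for `k_{i+1}`. -/
def matrixProduct (M : ℕ → Matrix (Fin 3) (Fin 3) ℝ) (k : ℕ → ℕ) (n : ℕ) :
    Matrix (Fin 3) (Fin 3) ℝ :=
  ((List.range n).map fun i => M (k i)).prod

/-- `l 0 ≥ l 1 ≥ l 2` are the Lyapunov exponents of a sequence `P` of matrices: the exponential
growth rates of the singular values (in decreasing order) exist and equal `l 0, l 1, l 2`. -/
def HasLyapunovExponents (P : ℕ → Matrix (Fin 3) (Fin 3) ℝ) (l : Fin 3 → ℝ) : Prop :=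
  ∀ i : Fin 3, Tendsto
    (fun n : ℕ => Real.log ((Matrix.toEuclideanLin (P n)).singularValues i) / n) atTop (𝓝 (l i))

end

/-! The argument compares two nonnegative matrix cocycles. Conjugating the transpose of `B₃ k` by a
signed permutation gives the inverse of `A₃ k` (`A₃_mul_duality`), so the exponents of the two
products are opposite. All matrices have determinant `-1`. Hence if `a` and `b` are the growth rates
of the norms of the products of `A₃` and of `B₃`, the exponents are `a, b - a, -b` for `A₃` and `b,
a - b, -a` for `B₃` (`hasLyapunovExponents_A₃_B₃`). Everything follows from `a < b`: it makes `b -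
a` positive, and the ordering `b - a ≤ a` makes `a` positive too.

To compare `a` with `b`, `B₃ k` is conjugated by a fixed invertible matrix to `lengthMatrix k`,
which dominates `A₃ k` entrywise. The largest ratio of entries of the two products is
submultiplicative and at most `1`, so its logarithm is a nonpositive subadditive process. By
`IsBoundedSubadditive.ae_upper_neg` such a process decreases linearly on almost every orbit where it
is negative at some time, which yields `a < b` there (`ae_exists_growth_lt`). The ratio drops below
`1` once all nine entries differ strictly, and digits exceeding `1` infinitely often along both
parities force this (`exists_matrixProduct_A₃_lt`).

The digits are unbounded, so the subadditive theorem is applied over the slow induction, where only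
two matrices occur per cocycle and all logarithms grow at most linearly. A digit `k` is a block of
`k - 1` shears and one return matrix. The mean block length is almost everywhere finite and positive
(`ae_tendsto_digitTime`), so rates per slow step become rates per digit after multiplication by it.
-/

/-! ### Kingman's theorem for bounded subadditive processes -/

section Kingman

variable {X : Type*} [MeasurableSpace X] {μ : Measure X} {T : X → X} {g : ℕ → X → ℝ} {C : ℝ}

/-- A measurable subadditive process over `T` which grows at most linearly, with rate `C`. -/
structure IsBoundedSubadditive (T : X → X) (g : ℕ → X → ℝ) (C : ℝ) : Prop where
  measurable : ∀ n, Measurable (g n)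
  bound : ∀ n x, |g n x| ≤ C * n
  subadd : ∀ m n x, g (m + n) x ≤ g m x + g n (T^[m] x)

namespace IsBoundedSubadditive

/-- The lower growth rate of a process. -/
noncomputable def lower (g : ℕ → X → ℝ) (x : X) : ℝ := liminf (fun n : ℕ => g n x / n) atTop

/-- The upper growth rate of a process. -/
noncomputable def upper (g : ℕ → X → ℝ) (x : X) : ℝ := limsup (fun n : ℕ => g n x / n) atTop

theorem rate_nonneg (h : IsBoundedSubadditive T g C) (x : X) : 0 ≤ C := by
  have := (abs_nonneg _).trans (h.bound 1 x)
  simpa using this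

theorem abs_div_le (h : IsBoundedSubadditive T g C) (n : ℕ) (x : X) : |g n x / n| ≤ C := by
  rcases n.eq_zero_or_pos with rfl | hn
  · simpa using h.rate_nonneg x
  · have : (0 : ℝ) < n := by exact_mod_cast hn
    rw [abs_div, abs_of_pos this, div_le_iff₀ this]
    exact h.bound n x

theorem isBoundedUnder_le (h : IsBoundedSubadditive T g C) (x : X) :
    IsBoundedUnder (· ≤ ·) atTop fun n : ℕ => g n x / n :=
  isBoundedUnder_of ⟨C, fun n => (abs_le.1 (h.abs_div_le n x)).2⟩

theorem isBoundedUnder_ge (h : IsBoundedSubadditive T g C) (x : X) :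
    IsBoundedUnder (· ≥ ·) atTop fun n : ℕ => g n x / n :=
  isBoundedUnder_of ⟨-C, fun n => (abs_le.1 (h.abs_div_le n x)).1⟩

theorem measurable_lower (h : IsBoundedSubadditive T g C) : Measurable (lower g) :=
  Measurable.liminf fun n => (h.measurable n).div_const _

theorem measurable_upper (h : IsBoundedSubadditive T g C) : Measurable (upper g) :=
  Measurable.limsup fun n => (h.measurable n).div_const _

theorem lower_le_upper (h : IsBoundedSubadditive T g C) (x : X) : lower g x ≤ upper g x :=
  liminf_le_limsup (h.isBoundedUnder_le x) (h.isBoundedUnder_ge x)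

theorem neg_le_lower (h : IsBoundedSubadditive T g C) (x : X) : -C ≤ lower g x :=
  le_liminf_of_le (h.isBoundedUnder_le x).isCoboundedUnder_ge
    (.of_forall fun n => (abs_le.1 (h.abs_div_le n x)).1)

theorem upper_le (h : IsBoundedSubadditive T g C) (x : X) : upper g x ≤ C :=
  limsup_le_of_le (h.isBoundedUnder_ge x).isCoboundedUnder_le
    (.of_forall fun n => (abs_le.1 (h.abs_div_le n x)).2)

theorem abs_lower_le (h : IsBoundedSubadditive T g C) (x : X) : |lower g x| ≤ C :=
  abs_le.2 ⟨h.neg_le_lower x, (h.lower_le_upper x).trans (h.upper_le x)⟩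

theorem abs_upper_le (h : IsBoundedSubadditive T g C) (x : X) : |upper g x| ≤ C :=
  abs_le.2 ⟨(h.neg_le_lower x).trans (h.lower_le_upper x), h.upper_le x⟩

theorem integrable (h : IsBoundedSubadditive T g C) [IsFiniteMeasure μ] (n : ℕ) :
    Integrable (g n) μ :=
  .of_bound (h.measurable n).aestronglyMeasurable (C * n) (.of_forall (h.bound n))

theorem integrable_lower (h : IsBoundedSubadditive T g C) [IsFiniteMeasure μ] :
    Integrable (lower g) μ :=
  .of_bound h.measurable_lower.aestronglyMeasurable C (.of_forall h.abs_lower_le)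

theorem integrable_upper (h : IsBoundedSubadditive T g C) [IsFiniteMeasure μ] :
    Integrable (upper g) μ :=
  .of_bound h.measurable_upper.aestronglyMeasurable C (.of_forall h.abs_upper_le)

/-- Along the shifted orbit, `g n (T x) / n` exceeds `g (n + 1) x / (n + 1)` up to `2 C / n`. -/
theorem div_succ_le (h : IsBoundedSubadditive T g C) (n : ℕ) (x : X) :
    g (n + 1) x / ((n + 1 : ℕ) : ℝ) - 2 * C / ((n + 1 : ℕ) : ℝ) ≤ g n (T x) / n := by
  -- One `C` pays for the first step `g 1 x`, the other for replacing the denominator `n` by `n +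
  -- 1`.
  have h1 := h.subadd 1 n x
  have h2 := (abs_le.1 (h.bound 1 x)).2
  have h3 := (abs_le.1 (h.abs_div_le n (T x))).1
  have h5 : g n (T x) = g n (T x) / n * n := by
    rcases n.eq_zero_or_pos with rfl | hn
    · have := h.bound 0 (T x)
      simpa using this
    · have : (n : ℝ) ≠ 0 := by positivity
      field_simp
  have h4 : (0 : ℝ) < ((n + 1 : ℕ) : ℝ) := by positivity
  rw [← sub_div, div_le_iff₀ h4]
  rw [add_comm 1 n, Function.iterate_one, h5] at h1
  push_cast at *
  nlinarith

theorem tendsto_const_div_succ (c : ℝ) :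
    Tendsto (fun n : ℕ => c / ((n + 1 : ℕ) : ℝ)) atTop (𝓝 0) :=
  (tendsto_const_div_atTop_nhds_zero_nat c).comp (tendsto_add_atTop_nat 1)

/-! ### Monotonicity and invariance of the growth rates along orbits -/

theorem lower_le_lower_comp (h : IsBoundedSubadditive T g C) (x : X) :
    lower g x ≤ lower g (T x) := by
  refine le_of_forall_pos_le_add fun ε hε => ?_
  have hd : lower g x - ε / 2 < lower g x := by linarith
  rw [← sub_le_iff_le_add]
  refine le_liminf_of_le (h.isBoundedUnder_le _).isCoboundedUnder_ge ?_
  have h1 := (tendsto_add_atTop_nat 1).eventually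
    (eventually_lt_of_lt_liminf hd (h.isBoundedUnder_ge x))
  have h2 := (tendsto_const_div_succ (2 * C)).eventually (gt_mem_nhds (half_pos hε))
  filter_upwards [h1, h2] with n h1 h2
  have := h.div_succ_le n x
  linarith

theorem upper_le_upper_comp (h : IsBoundedSubadditive T g C) (x : X) :
    upper g x ≤ upper g (T x) := by
  refine le_of_forall_pos_le_add fun ε hε => ?_
  have hlt : upper g (T x) < upper g (T x) + ε / 2 := by linarith
  have h1 := eventually_lt_of_limsup_lt hlt (h.isBoundedUnder_le (T x))
  have h2 := (tendsto_const_div_succ (2 * C)).eventually (gt_mem_nhds (half_pos hε))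
  refine limsup_le_of_le (h.isBoundedUnder_ge _).isCoboundedUnder_le ?_
  have : ∀ᶠ n : ℕ in atTop, g (n + 1) x / ((n + 1 : ℕ) : ℝ) ≤ upper g (T x) + ε := by
    filter_upwards [h1, h2] with n h1 h2
    have := h.div_succ_le n x
    linarith
  exact (eventually_atTop.2 <| by
    obtain ⟨N, hN⟩ := eventually_atTop.1 this
    refine ⟨N + 1, fun n hn => ?_⟩
    obtain ⟨m, rfl⟩ := Nat.exists_eq_add_of_le' (Nat.one_le_of_lt hn)
    exact hN m (by omega))

/-- The rate can only increase along an orbit, while its integral is preserved by `T`; a nonnegative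
difference with zero integral vanishes almost everywhere. -/
theorem ae_lower_comp [IsFiniteMeasure μ] (hT : MeasurePreserving T μ μ)
    (h : IsBoundedSubadditive T g C) : ∀ᵐ x ∂μ, lower g (T x) = lower g x := by
  have hi : Integrable (fun x => lower g (T x)) μ :=
    hT.integrable_comp_of_integrable (g := lower g) h.integrable_lower
  have h0 : ∫ x, (lower g (T x) - lower g x) ∂μ = 0 := by
    rw [integral_sub hi h.integrable_lower, sub_eq_zero, ← integral_map hT.aemeasurable, hT.map_eq]
    rw [hT.map_eq]
    exact h.measurable_lower.aestronglyMeasurable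
  have := (integral_eq_zero_iff_of_nonneg
    (fun x => sub_nonneg.2 (h.lower_le_lower_comp x)) (hi.sub h.integrable_lower)).1 h0
  filter_upwards [this] with x hx
  exact sub_eq_zero.1 hx

theorem ae_lower_iterate [IsFiniteMeasure μ] (hT : MeasurePreserving T μ μ)
    (h : IsBoundedSubadditive T g C) : ∀ᵐ x ∂μ, ∀ k, lower g (T^[k] x) = lower g x := by
  have h1 : ∀ᵐ x ∂μ, ∀ k, lower g (T (T^[k] x)) = lower g (T^[k] x) :=
    ae_all_iff.2 fun k => (hT.iterate k).quasiMeasurePreserving.ae (ae_lower_comp hT h)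
  filter_upwards [h1] with x hx k
  induction k with
  | zero => rfl
  | succ k ih => rw [Function.iterate_succ_apply', hx, ih]

/-! ### Lower bound for the integral of the lower rate -/

/-- The points at which no time up to `N` realizes the lower rate up to `ε`. -/
def badSet (g : ℕ → X → ℝ) (ε : ℝ) (N : ℕ) : Set X :=
  {x | ∀ l ∈ Finset.Icc 1 N, l * (lower g x + ε) < g l x}

theorem measurableSet_badSet (h : IsBoundedSubadditive T g C) (ε : ℝ) (N : ℕ) :
    MeasurableSet (badSet g ε N) := by
  have : badSet g ε N = ⋂ l ∈ Finset.Icc 1 N, {x | l * (lower g x + ε) < g l x} := by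
    ext; simp [badSet]
  rw [this]
  exact Finset.measurableSet_biInter _ fun l _ =>
    measurableSet_lt ((h.measurable_lower.add_const ε).const_mul _) (h.measurable l)

theorem iInter_badSet (h : IsBoundedSubadditive T g C) {ε : ℝ} (hε : 0 < ε) :
    ⋂ N, badSet g ε N = ∅ := by
  refine Set.eq_empty_of_forall_notMem fun x hx => ?_
  have hlt : lower g x < lower g x + ε := by linarith
  have h1 := frequently_lt_of_liminf_lt (h.isBoundedUnder_le x).isCoboundedUnder_ge hlt
  obtain ⟨n, hn, hn1⟩ := (h1.and_eventually (eventually_ge_atTop 1)).exists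
  have h2 := Set.mem_iInter.1 hx n n (Finset.mem_Icc.2 ⟨hn1, le_rfl⟩)
  have : (0 : ℝ) < n := by exact_mod_cast hn1
  rw [div_lt_iff₀ this] at hn
  linarith

theorem tendsto_badSet [IsFiniteMeasure μ] (h : IsBoundedSubadditive T g C) {ε : ℝ} (hε : 0 < ε) :
    Tendsto (fun N => μ.real (badSet g ε N)) atTop (𝓝 0) := by
  have h1 : Tendsto (μ ∘ badSet g ε) atTop (𝓝 (μ (⋂ N, badSet g ε N))) := by
    refine tendsto_measure_iInter_atTop
      (fun N => (h.measurableSet_badSet ε N).nullMeasurableSet) ?_ ⟨0, measure_ne_top _ _⟩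
    intro M N hMN x hx l hl
    exact hx l (Finset.Icc_subset_Icc le_rfl hMN hl)
  rw [h.iInter_badSet hε, measure_empty] at h1
  exact (ENNReal.tendsto_toReal ENNReal.zero_ne_top).comp h1

/-- Greedy covering of the orbit segment of length `n`. From a good point one jumps over a time `l ≤
N` that realizes the lower rate up to `ε`. From a bad point one moves a single step, which costs at
most `C ≤ lower g x + 2 * C`. The last incomplete jump, shorter than `N`, accounts for `2 * C * N`.
-/
theorem le_sum_badSet (h : IsBoundedSubadditive T g C) {ε : ℝ} (hε : 0 < ε) (N n : ℕ) (x : X)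
    (hx : ∀ k, lower g (T^[k] x) = lower g x) :
    g n x ≤ n * (lower g x + ε) +
      2 * C * ∑ k ∈ Finset.range n, (badSet g ε N).indicator 1 (T^[k] x) + 2 * C * N := by
  have hC := h.rate_nonneg x
  induction n using Nat.strong_induction_on generalizing x with
  | _ n ih =>
  have hlow := h.neg_le_lower x
  have hind : ∀ y, 0 ≤ (badSet g ε N).indicator (1 : X → ℝ) y :=
    fun y => Set.indicator_nonneg (fun _ _ => zero_le_one) y
  have hsplit : ∀ l m : ℕ, ∑ k ∈ Finset.range (l + m), (badSet g ε N).indicator (1 : X → ℝ) (T^[k] x)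
      = ∑ k ∈ Finset.range l, (badSet g ε N).indicator (1 : X → ℝ) (T^[k] x) +
        ∑ k ∈ Finset.range m, (badSet g ε N).indicator (1 : X → ℝ) (T^[k] (T^[l] x)) := by
    intro l m
    rw [Finset.sum_range_add]
    simp only [← Function.iterate_add_apply, add_comm]
  have hshift : ∀ l k, lower g (T^[k] (T^[l] x)) = lower g (T^[l] x) := by
    intro l k
    rw [← Function.iterate_add_apply, hx, hx]
  by_cases hb : x ∈ badSet g ε N
  · rcases n.eq_zero_or_pos with rfl | hn
    · have := (abs_le.1 (h.bound 0 x)).2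
      have h2 : 0 ≤ 2 * C * (N : ℝ) := by positivity
      simp only [Nat.cast_zero, mul_zero, zero_mul, Finset.range_zero, Finset.sum_empty] at *
      linarith
    · obtain ⟨m, rfl⟩ := Nat.exists_eq_add_of_le hn
      have h1 := ih m (by omega) (T^[1] x) (hshift 1)
      have h2 := h.subadd 1 m x
      have h3 := (abs_le.1 (h.bound 1 x)).2
      rw [hsplit, Finset.sum_range_one, Function.iterate_zero_apply, Set.indicator_of_mem hb]
      rw [hx] at h1
      simp only [Nat.cast_add, Nat.cast_one, Pi.one_apply] at *
      nlinarith
  · simp only [badSet, Set.mem_ofPred_eq, not_forall, not_lt, Finset.mem_Icc] at hb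
    obtain ⟨l, ⟨hl1, hlN⟩, hl⟩ := hb
    by_cases hln : l ≤ n
    · obtain ⟨m, rfl⟩ := Nat.exists_eq_add_of_le hln
      have h1 := ih m (by omega) (T^[l] x) (hshift l)
      have h2 := h.subadd l m x
      have h3 : 0 ≤ ∑ k ∈ Finset.range l, (badSet g ε N).indicator (1 : X → ℝ) (T^[k] x) :=
        Finset.sum_nonneg fun k _ => hind _
      rw [hsplit]
      rw [hx] at h1
      push_cast
      nlinarith [mul_nonneg hC h3]
    -- The good jump overshoots the segment: fewer than `N` steps remain and the trivial bound is
    -- enough.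
    · have h1 := (abs_le.1 (h.bound n x)).2
      have h3 : 0 ≤ ∑ k ∈ Finset.range n, (badSet g ε N).indicator (1 : X → ℝ) (T^[k] x) :=
        Finset.sum_nonneg fun k _ => hind _
      have h4 : (n : ℝ) ≤ N := by exact_mod_cast (by omega : n ≤ N)
      have h5 : (0 : ℝ) ≤ n := n.cast_nonneg
      nlinarith [mul_nonneg hC h3, mul_nonneg hC h5, mul_le_mul_of_nonneg_left h4 hC,
        mul_nonneg h5 (by linarith : 0 ≤ lower g x + ε + C)]

/-- Integrate the covering estimate and divide by `n`. The limits are then taken in the order `n →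
∞`, `N → ∞` (the bad sets shrink to the empty set), `ε → 0`. -/
theorem le_integral_lower [IsFiniteMeasure μ] (hT : MeasurePreserving T μ μ)
    (h : IsBoundedSubadditive T g C) {a : ℝ} (ha : ∀ n : ℕ, n * a ≤ ∫ x, g n x ∂μ) :
    a ≤ ∫ x, lower g x ∂μ := by
  have key : ∀ ε > 0, ∀ N n : ℕ, n * a ≤
      n * (∫ x, lower g x ∂μ + ε * μ.real Set.univ + 2 * C * μ.real (badSet g ε N)) +
        2 * C * N * μ.real Set.univ := by
    intro ε hε N n
    have hmeas := h.measurableSet_badSet ε N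
    have hint : ∀ k, Integrable (fun x => (badSet g ε N).indicator (1 : X → ℝ) (T^[k] x)) μ :=
      fun k => (hT.iterate k).integrable_comp_of_integrable
        (g := (badSet g ε N).indicator (1 : X → ℝ))
        ((integrable_const (1 : ℝ)).indicator hmeas)
    have hk : ∀ k, ∫ x, (badSet g ε N).indicator (1 : X → ℝ) (T^[k] x) ∂μ =
        μ.real (badSet g ε N) := by
      intro k
      rw [← integral_map (hT.iterate k).aemeasurable, (hT.iterate k).map_eq,
        integral_indicator_one hmeas]
      rw [(hT.iterate k).map_eq]
      exact (measurable_one.indicator hmeas).aestronglyMeasurable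
    have hA : Integrable (fun x => n * (lower g x + ε)) μ :=
      (h.integrable_lower.add (integrable_const ε)).const_mul _
    have hB : Integrable (fun x => 2 * C * ∑ k ∈ Finset.range n,
        (badSet g ε N).indicator (1 : X → ℝ) (T^[k] x)) μ :=
      (integrable_finsetSum _ fun k _ => hint k).const_mul _
    refine (ha n).trans ((integral_mono_ae (h.integrable n) ((hA.add hB).add
      (integrable_const (2 * C * N))) ?_).trans_eq ?_)
    · filter_upwards [ae_lower_iterate hT h] with x hx
      exact h.le_sum_badSet hε N n x hx
    · rw [integral_add' (hA.add hB) (integrable_const _), integral_add' hA hB, integral_const_mul,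
        integral_const_mul, integral_finsetSum _ (fun k _ => hint k),
        integral_add h.integrable_lower (integrable_const _)]
      simp only [hk, integral_const, Finset.sum_const, Finset.card_range, smul_eq_mul,
        nsmul_eq_mul]
      ring
  have key2 : ∀ ε > 0, ∀ N : ℕ, a ≤
      ∫ x, lower g x ∂μ + ε * μ.real Set.univ + 2 * C * μ.real (badSet g ε N) := by
    intro ε hε N
    refine ge_of_tendsto (x := atTop (α := ℕ)) (f := fun n : ℕ =>
      (∫ x, lower g x ∂μ + ε * μ.real Set.univ + 2 * C * μ.real (badSet g ε N)) +
        2 * C * N * μ.real Set.univ / n) ?_ ?_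
    · simpa using (tendsto_const_div_atTop_nhds_zero_nat
        (2 * C * N * μ.real Set.univ)).const_add _
    · filter_upwards [eventually_ge_atTop 1] with n hn
      have hn' : (0 : ℝ) < n := by exact_mod_cast hn
      have := key ε hε N n
      rw [← mul_le_mul_iff_right₀ hn', mul_add, mul_div_cancel₀ _ hn'.ne']
      exact this
  have key3 : ∀ ε > 0, a ≤ ∫ x, lower g x ∂μ + ε * μ.real Set.univ := by
    intro ε hε
    refine ge_of_tendsto (x := atTop (α := ℕ)) ?_ (.of_forall (key2 ε hε))
    simpa using ((h.tendsto_badSet (μ := μ) hε).const_mul (2 * C)).const_add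
      (∫ x, lower g x ∂μ + ε * μ.real Set.univ)
  refine ge_of_tendsto (x := 𝓝[>] (0 : ℝ)) (f := fun ε =>
    ∫ x, lower g x ∂μ + ε * μ.real Set.univ) ?_ (eventually_mem_nhdsWithin.mono key3)
  have : Tendsto (fun ε : ℝ => ∫ x, lower g x ∂μ + ε * μ.real Set.univ) (𝓝 0)
      (𝓝 (∫ x, lower g x ∂μ + 0 * μ.real Set.univ)) := by
    refine Continuous.tendsto (by fun_prop) 0
  simpa using this.mono_left nhdsWithin_le_nhds

/-! ### Upper bound for the upper rate by blocks of fixed length -/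

/-- The additive process with the opposite of `g m` as first term, over the `m`th iterate. -/
noncomputable def blockSum (T : X → X) (g : ℕ → X → ℝ) (m j : ℕ) (x : X) : ℝ :=
  ∑ i ∈ Finset.range j, -g m ((T^[m])^[i] x)

theorem isBoundedSubadditive_blockSum (hT : Measurable T) (h : IsBoundedSubadditive T g C) (m : ℕ) :
    IsBoundedSubadditive T^[m] (blockSum T g m) (C * m) where
  measurable j := Finset.measurable_sum _ fun i _ =>
    ((h.measurable m).comp ((hT.iterate m).iterate i)).neg
  bound j x := by
    refine (Finset.abs_sum_le_sum_abs _ _).trans ?_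
    refine (Finset.sum_le_card_nsmul _ _ (C * m) fun i _ => ?_).trans_eq ?_
    · rw [abs_neg]; exact h.bound m _
    · simp [mul_comm]
  subadd i j x := by
    simp only [blockSum]
    rw [Finset.sum_range_add]
    simp only [← Function.iterate_add_apply (T^[m]), add_comm]
    exact le_rfl

theorem le_blockSum (h : IsBoundedSubadditive T g C) (m j r : ℕ) (x : X) :
    g (m * j + r) x ≤ -blockSum T g m j x + C * r := by
  induction j generalizing x with
  | zero => simpa [blockSum] using (abs_le.1 (h.bound r x)).2
  | succ j ih =>
    have h1 := h.subadd m (m * j + r) x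
    have h2 := ih (T^[m] x)
    have h3 : blockSum T g m (j + 1) x = blockSum T g m j (T^[m] x) - g m x := by
      simp only [blockSum]
      rw [Finset.sum_range_succ']
      simp [Function.iterate_succ_apply, sub_eq_add_neg]
    rw [show m * (j + 1) + r = m + (m * j + r) by ring]
    linarith

/-- Cutting `n` into blocks of length `m` bounds `g n` by a sum of values of `g m`, up to a
remainder of at most `C * m`. The sign in `blockSum` turns this upper bound into a statement on a
lower rate, to which `le_integral_lower` applies. -/
theorem upper_le_blockSum (hT : Measurable T) (h : IsBoundedSubadditive T g C) {m : ℕ} (hm : 0 < m)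
    (x : X) : m * upper g x ≤ -lower (blockSum T g m) x := by
  have hb := h.isBoundedSubadditive_blockSum hT m
  have hm' : (0 : ℝ) < m := by exact_mod_cast hm
  have hC := h.rate_nonneg x
  rw [le_neg]
  refine le_of_forall_lt fun c hc => ?_
  obtain ⟨d, hcd, hd⟩ := exists_between hc
  refine hcd.trans_le ?_
  rw [le_neg, ← le_div_iff₀' hm']
  have h1 := eventually_lt_of_lt_liminf hd (hb.isBoundedUnder_ge x)
  have h2 : Tendsto (fun n : ℕ => n / m) atTop atTop := Nat.tendsto_div_const_atTop hm.ne'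
  have h3 := h2.eventually (h1.and (eventually_ge_atTop 1))
  have h4 : Tendsto (fun n : ℕ => -d / m + (C * m + |d|) / (n : ℝ)) atTop (𝓝 (-d / m)) := by
    simpa using (tendsto_const_div_atTop_nhds_zero_nat (C * m + |d|)).const_add (-d / m)
  rw [← h4.limsup_eq]
  refine limsup_le_limsup ?_ (h.isBoundedUnder_ge _).isCoboundedUnder_le h4.isBoundedUnder_le
  filter_upwards [h3, eventually_ge_atTop 1] with n ⟨hn, hj⟩ hn1
  have hn' : (0 : ℝ) < n := by exact_mod_cast hn1
  have hj' : (0 : ℝ) < (n / m : ℕ) := by exact_mod_cast hj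
  have h5 := h.le_blockSum m (n / m) (n % m) x
  rw [Nat.div_add_mod] at h5
  have h6 : ((n % m : ℕ) : ℝ) ≤ m := by exact_mod_cast (Nat.mod_lt n hm).le
  have h7 : (m : ℝ) * (n / m : ℕ) + (n % m : ℕ) = n := by exact_mod_cast Nat.div_add_mod n m
  rw [lt_div_iff₀ hj'] at hn
  have h8 : -d / m + (C * m + |d|) / n = (-d * n / m + C * m + |d|) / n := by
    field_simp
    ring
  rw [h8]
  refine div_le_div_of_nonneg_right ?_ hn'.le
  have h9 : -d * n / m = -d * (n / m : ℕ) - d * ((n % m : ℕ) / m) := by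
    rw [← h7]; field_simp; ring
  have h10 : d * ((n % m : ℕ) / m) ≤ |d| := by
    have h11 : ((n % m : ℕ) : ℝ) / m ≤ 1 := (div_le_one hm').2 h6
    have h12 : (0 : ℝ) ≤ ((n % m : ℕ) : ℝ) / m := by positivity
    nlinarith [le_abs_self d, abs_nonneg d]
  rw [h9]
  nlinarith [mul_le_mul_of_nonneg_left h6 hC]

/-- The block process is additive, so its integrals are exactly `-j * ∫ g m` and satisfy the
hypothesis of `le_integral_lower` with equality. -/
theorem integral_upper_le [IsFiniteMeasure μ] (hT : MeasurePreserving T μ μ)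
    (h : IsBoundedSubadditive T g C) {m : ℕ} (hm : 0 < m) :
    m * ∫ x, upper g x ∂μ ≤ ∫ x, g m x ∂μ := by
  have hb := h.isBoundedSubadditive_blockSum hT.measurable m
  have h1 : -∫ x, g m x ∂μ ≤ ∫ x, lower (blockSum T g m) x ∂μ := by
    refine le_integral_lower (hT.iterate m) hb fun j => le_of_eq ?_
    have hi : ∀ i, Integrable (fun x => -g m ((T^[m])^[i] x)) μ := fun i =>
      (((hT.iterate m).iterate i).integrable_comp_of_integrable (h.integrable m)).neg
    simp only [blockSum]
    rw [integral_finsetSum _ fun i _ => hi i]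
    have : ∀ i, ∫ x, -g m ((T^[m])^[i] x) ∂μ = -∫ x, g m x ∂μ := by
      intro i
      rw [integral_neg, ← integral_map ((hT.iterate m).iterate i).aemeasurable,
        ((hT.iterate m).iterate i).map_eq]
      rw [((hT.iterate m).iterate i).map_eq]
      exact (h.measurable m).aestronglyMeasurable
    simp [this]
  have h2 : ∫ x, m * upper g x ∂μ ≤ ∫ x, -lower (blockSum T g m) x ∂μ :=
    integral_mono (h.integrable_upper.const_mul _) hb.integrable_lower.neg
      fun x => h.upper_le_blockSum hT.measurable hm x
  rw [integral_const_mul, integral_neg] at h2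
  linarith

/-- Kingman's theorem: the growth rate exists almost everywhere. -/
theorem ae_tendsto [IsFiniteMeasure μ] (hT : MeasurePreserving T μ μ)
    (h : IsBoundedSubadditive T g C) :
    ∀ᵐ x ∂μ, Tendsto (fun n : ℕ => g n x / n) atTop (𝓝 (upper g x)) := by
  have h1 : ∫ x, upper g x ∂μ ≤ ∫ x, lower g x ∂μ := by
    -- The bound `n * ∫ upper g ≤ ∫ g n` is precisely the hypothesis of `le_integral_lower` with `a
    -- = ∫ upper g`.
    refine le_integral_lower hT h fun n => ?_
    rcases n.eq_zero_or_pos with rfl | hn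
    · have : ∀ x, g 0 x = 0 := fun x => by simpa using h.bound 0 x
      simp [this]
    · exact integral_upper_le hT h hn
  have h2 : ∫ x, (upper g x - lower g x) ∂μ = 0 := by
    rw [integral_sub h.integrable_upper h.integrable_lower]
    exact le_antisymm (by linarith) (sub_nonneg.2 <|
      integral_mono h.integrable_lower h.integrable_upper h.lower_le_upper)
  have h3 := (integral_eq_zero_iff_of_nonneg (fun x => sub_nonneg.2 (h.lower_le_upper x))
    (h.integrable_upper.sub h.integrable_lower)).1 h2
  filter_upwards [h3] with x hx
  exact tendsto_of_liminf_eq_limsup (sub_eq_zero.1 hx).symm rfl (h.isBoundedUnder_le x)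
    (h.isBoundedUnder_ge x)

/-- A nonpositive subadditive process decreases linearly along almost every orbit on which it
takes a negative value. -/
theorem ae_upper_neg [IsFiniteMeasure μ] (hT : MeasurePreserving T μ μ)
    (h : IsBoundedSubadditive T g C) (hg : ∀ n x, g n x ≤ 0) :
    ∀ᵐ x ∂μ, (∃ m, g m x < 0) → upper g x < 0 := by
  -- This set is invariant up to a null set, because the upper rate increases along orbits. Thus `T`
  -- preserves the restricted measure, and `integral_upper_le` on `E` forces each nonpositive `g m`
  -- to have integral zero there.
  set E : Set X := {x | 0 ≤ upper g x} with hE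
  have hEm : MeasurableSet E := measurableSet_le measurable_const h.measurable_upper
  have hsub : E ⊆ T ⁻¹' E := fun x (hx : 0 ≤ upper g x) =>
    hx.trans (h.upper_le_upper_comp x)
  have hEE : E =ᵐ[μ] T ⁻¹' E := ae_eq_of_subset_of_measure_ge hsub
    (hT.measure_preimage hEm.nullMeasurableSet).le hEm.nullMeasurableSet (measure_ne_top _ _)
  have hTE : MeasurePreserving T (μ.restrict E) (μ.restrict E) := by
    refine ⟨hT.measurable, ?_⟩
    conv_lhs => rw [Measure.restrict_congr_set hEE]
    exact (hT.restrict_preimage hEm).map_eq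
  have h1 : ∀ m, ∀ᵐ x ∂μ.restrict E, g m x = 0 := by
    intro m
    rcases m.eq_zero_or_pos with rfl | hm
    · exact .of_forall fun x => by simpa using h.bound 0 x
    have h2 := integral_upper_le hTE h hm
    have h3 : 0 ≤ ∫ x in E, upper g x ∂μ := setIntegral_nonneg hEm fun x hx => hx
    have h4 : ∫ x in E, -g m x ∂μ = 0 := by
      refine le_antisymm ?_ (integral_nonneg fun x => neg_nonneg.2 (hg m x))
      rw [integral_neg]
      have : 0 ≤ (m : ℝ) * ∫ x in E, upper g x ∂μ := by positivity
      linarith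
    have h5 := (integral_eq_zero_iff_of_nonneg (fun x => neg_nonneg.2 (hg m x))
      (h.integrable m).neg).1 h4
    filter_upwards [h5] with x hx
    exact neg_eq_zero.1 hx
  have h6 := (ae_restrict_iff' hEm).1 (ae_all_iff.2 h1)
  filter_upwards [h6] with x hx ⟨m, hm⟩
  by_contra! hc
  exact hm.ne (hx hc m)

end IsBoundedSubadditive

end Kingman

/-! ### Norms, singular values and Lyapunov exponents of matrices -/

section Matrices

/-- The operator norm of a matrix for the maximum norm: the maximal row sum of absolute values. -/
noncomputable def rowNorm (M : Matrix (Fin 3) (Fin 3) ℝ) : ℝ :=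
  Finset.univ.sup' Finset.univ_nonempty fun i => ∑ j, |M i j|

theorem rowNorm_le_iff {M : Matrix (Fin 3) (Fin 3) ℝ} {c : ℝ} :
    rowNorm M ≤ c ↔ ∀ i, ∑ j, |M i j| ≤ c := by
  simp [rowNorm]

theorem sum_abs_le_rowNorm (M : Matrix (Fin 3) (Fin 3) ℝ) (i : Fin 3) :
    ∑ j, |M i j| ≤ rowNorm M :=
  rowNorm_le_iff.1 le_rfl i

theorem abs_le_rowNorm (M : Matrix (Fin 3) (Fin 3) ℝ) (i j : Fin 3) : |M i j| ≤ rowNorm M :=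
  (Finset.single_le_sum (f := fun j => |M i j|) (fun _ _ => abs_nonneg _)
    (Finset.mem_univ j)).trans (sum_abs_le_rowNorm M i)

theorem rowNorm_nonneg (M : Matrix (Fin 3) (Fin 3) ℝ) : 0 ≤ rowNorm M :=
  (abs_nonneg _).trans (abs_le_rowNorm M 0 0)

theorem rowNorm_one : rowNorm 1 = 1 := by
  have h : ∀ i : Fin 3, ∑ j, |(1 : Matrix (Fin 3) (Fin 3) ℝ) i j| = 1 := by
    intro i
    fin_cases i <;> simp [Fin.sum_univ_three, Matrix.one_apply]
  exact le_antisymm (rowNorm_le_iff.2 fun i => (h i).le) ((h 0).ge.trans (sum_abs_le_rowNorm 1 0))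

theorem rowNorm_mul (M N : Matrix (Fin 3) (Fin 3) ℝ) :
    rowNorm (M * N) ≤ rowNorm M * rowNorm N := by
  refine rowNorm_le_iff.2 fun i => ?_
  calc ∑ j, |(M * N) i j| ≤ ∑ j, ∑ l, |M i l| * |N l j| := by
        refine Finset.sum_le_sum fun j _ => ?_
        rw [Matrix.mul_apply]
        refine (Finset.abs_sum_le_sum_abs _ _).trans_eq ?_
        simp [abs_mul]
    _ = ∑ l, |M i l| * ∑ j, |N l j| := by
        rw [Finset.sum_comm]
        simp [Finset.mul_sum]
    _ ≤ ∑ l, |M i l| * rowNorm N := Finset.sum_le_sum fun l _ =>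
        mul_le_mul_of_nonneg_left (sum_abs_le_rowNorm N l) (abs_nonneg _)
    _ ≤ rowNorm M * rowNorm N := by
        rw [← Finset.sum_mul]
        exact mul_le_mul_of_nonneg_right (sum_abs_le_rowNorm M i) (rowNorm_nonneg N)

theorem rowNorm_le_mul {M N : Matrix (Fin 3) (Fin 3) ℝ} {c : ℝ}
    (h : ∀ i j, |M i j| ≤ c * |N i j|) (hc : 0 ≤ c) : rowNorm M ≤ c * rowNorm N := by
  refine rowNorm_le_iff.2 fun i => (Finset.sum_le_sum fun j _ => h i j).trans ?_
  rw [← Finset.mul_sum]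
  exact mul_le_mul_of_nonneg_left (sum_abs_le_rowNorm N i) hc

theorem rowNorm_le_three_mul {M : Matrix (Fin 3) (Fin 3) ℝ} {c : ℝ} (h : ∀ i j, |M i j| ≤ c) :
    rowNorm M ≤ 3 * c := by
  refine rowNorm_le_iff.2 fun i => ?_
  rw [Fin.sum_univ_three]
  linarith [h i 0, h i 1, h i 2]

theorem rowNorm_transpose_le (M : Matrix (Fin 3) (Fin 3) ℝ) : rowNorm M.transpose ≤ 3 * rowNorm M :=
  rowNorm_le_three_mul fun i j => abs_le_rowNorm M j i

theorem rowNorm_pos_of_mul_eq_one {P Q : Matrix (Fin 3) (Fin 3) ℝ} (h : P * Q = 1) :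
    0 < rowNorm P := by
  have h1 := rowNorm_mul P Q
  rw [h, rowNorm_one] at h1
  by_contra! hc
  rw [le_antisymm hc (rowNorm_nonneg P), zero_mul] at h1
  linarith

/-! ### Singular values compared with row norms -/

theorem norm_toEuclideanLin_le (P : Matrix (Fin 3) (Fin 3) ℝ) (x : EuclideanSpace ℝ (Fin 3)) :
    ‖Matrix.toEuclideanLin P x‖ ≤ 3 * rowNorm P * ‖x‖ := by
  have h1 : ∀ i, |Matrix.toEuclideanLin P x i| ≤ rowNorm P * ‖x‖ := by
    intro i
    have : Matrix.toEuclideanLin P x i = ∑ j, P i j * x j := rfl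
    rw [this]
    refine (Finset.abs_sum_le_sum_abs _ _).trans ?_
    refine (Finset.sum_le_sum (g := fun j => |P i j| * ‖x‖) fun j _ => ?_).trans ?_
    · rw [abs_mul]
      exact mul_le_mul_of_nonneg_left (PiLp.norm_apply_le x j) (abs_nonneg _)
    · rw [← Finset.sum_mul]
      exact mul_le_mul_of_nonneg_right (sum_abs_le_rowNorm P i) (norm_nonneg x)
  have h0 := mul_nonneg (rowNorm_nonneg P) (norm_nonneg x)
  rw [EuclideanSpace.norm_eq, Fin.sum_univ_three, mul_assoc]
  refine Real.sqrt_le_iff.2 ⟨by positivity, ?_⟩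
  have h2 : ∀ i, ‖Matrix.toEuclideanLin P x i‖ ^ 2 ≤ (rowNorm P * ‖x‖) ^ 2 :=
    fun i => pow_le_pow_left₀ (norm_nonneg _) (h1 i) 2
  nlinarith [h2 0, h2 1, h2 2]

/-- Expansion in an orthonormal eigenbasis of `T* T`, whose eigenvalues are the squares of the
singular values. The extremal bounds below are read off from it. -/
theorem norm_sq_apply_eq_sum (T : EuclideanSpace ℝ (Fin 3) →ₗ[ℝ] EuclideanSpace ℝ (Fin 3))
    (x : EuclideanSpace ℝ (Fin 3)) :
    ‖T x‖ ^ 2 = ∑ i : Fin 3, T.singularValues i ^ 2 *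
      ((T.isSymmetric_adjoint_comp_self.eigenvectorBasis finrank_euclideanSpace_fin).repr x i) ^ 2
      := by
  set hS := T.isSymmetric_adjoint_comp_self
  set b := hS.eigenvectorBasis finrank_euclideanSpace_fin
  have h1 : ‖T x‖ ^ 2 = inner ℝ ((T.adjoint ∘ₗ T) x) x := by
    rw [LinearMap.comp_apply, LinearMap.adjoint_inner_left, real_inner_self_eq_norm_sq]
  rw [h1, ← b.repr.inner_map_map]
  have h2 : ∀ i, b.repr ((T.adjoint ∘ₗ T) x) i = T.singularValues i ^ 2 * b.repr x i := by
    intro i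
    rw [T.sq_singularValues_fin finrank_euclideanSpace_fin]
    exact hS.eigenvectorBasis_apply_self_apply finrank_euclideanSpace_fin x i
  simp only [PiLp.inner_apply, h2]
  refine Finset.sum_congr rfl fun i _ => ?_
  simp
  ring

theorem norm_sq_eq_sum_repr (b : OrthonormalBasis (Fin 3) ℝ (EuclideanSpace ℝ (Fin 3)))
    (x : EuclideanSpace ℝ (Fin 3)) : ‖x‖ ^ 2 = ∑ i, (b.repr x i) ^ 2 := by
  rw [← b.repr.norm_map, EuclideanSpace.norm_sq_eq]
  simp

theorem norm_apply_le_singularValues (T : EuclideanSpace ℝ (Fin 3) →ₗ[ℝ] EuclideanSpace ℝ (Fin 3))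
    (x : EuclideanSpace ℝ (Fin 3)) : ‖T x‖ ≤ T.singularValues 0 * ‖x‖ := by
  refine le_of_sq_le_sq ?_ (mul_nonneg (T.singularValues_nonneg 0) (norm_nonneg x))
  rw [norm_sq_apply_eq_sum, mul_pow, norm_sq_eq_sum_repr, Finset.mul_sum]
  refine Finset.sum_le_sum fun i _ => mul_le_mul_of_nonneg_right ?_ (sq_nonneg _)
  exact pow_le_pow_left₀ (T.singularValues_nonneg _) (T.singularValues_antitone (Nat.zero_le _)) 2

theorem singularValues_mul_norm_le (T : EuclideanSpace ℝ (Fin 3) →ₗ[ℝ] EuclideanSpace ℝ (Fin 3))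
    (x : EuclideanSpace ℝ (Fin 3)) : T.singularValues 2 * ‖x‖ ≤ ‖T x‖ := by
  refine le_of_sq_le_sq ?_ (norm_nonneg _)
  rw [norm_sq_apply_eq_sum, mul_pow, norm_sq_eq_sum_repr, Finset.mul_sum]
  refine Finset.sum_le_sum fun i _ => mul_le_mul_of_nonneg_right ?_ (sq_nonneg _)
  exact pow_le_pow_left₀ (T.singularValues_nonneg _) (T.singularValues_antitone (by omega)) 2

theorem exists_norm_apply_eq_singularValues
    (T : EuclideanSpace ℝ (Fin 3) →ₗ[ℝ] EuclideanSpace ℝ (Fin 3)) (i : Fin 3) :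
    ∃ x, ‖x‖ = 1 ∧ ‖T x‖ = T.singularValues i := by
  set b := T.isSymmetric_adjoint_comp_self.eigenvectorBasis finrank_euclideanSpace_fin with hb
  refine ⟨b i, b.norm_eq_one i, ?_⟩
  refine (sq_eq_sq₀ (norm_nonneg _) (T.singularValues_nonneg _)).1 ?_
  rw [norm_sq_apply_eq_sum, ← hb]
  simp

theorem toEuclideanLin_single (P : Matrix (Fin 3) (Fin 3) ℝ) (i j : Fin 3) :
    Matrix.toEuclideanLin P (EuclideanSpace.single j 1) i = P i j := by
  simp [Matrix.toLpLin_apply]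

theorem toEuclideanLin_comp_apply {P Q : Matrix (Fin 3) (Fin 3) ℝ} (h : P * Q = 1)
    (x : EuclideanSpace ℝ (Fin 3)) :
    Matrix.toEuclideanLin P (Matrix.toEuclideanLin Q x) = x := by
  simp [Matrix.toLpLin_apply, h]

theorem singularValues_zero_le (P : Matrix (Fin 3) (Fin 3) ℝ) :
    (Matrix.toEuclideanLin P).singularValues 0 ≤ 3 * rowNorm P := by
  obtain ⟨x, hx, h⟩ := exists_norm_apply_eq_singularValues (Matrix.toEuclideanLin P) 0
  have := norm_toEuclideanLin_le P x
  rw [hx, mul_one, h] at this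
  exact this

theorem rowNorm_le_singularValues (P : Matrix (Fin 3) (Fin 3) ℝ) :
    rowNorm P ≤ 3 * (Matrix.toEuclideanLin P).singularValues 0 := by
  refine rowNorm_le_three_mul fun i j => ?_
  rw [← toEuclideanLin_single P i j]
  refine (PiLp.norm_apply_le (Matrix.toEuclideanLin P (EuclideanSpace.single j 1)) i).trans ?_
  simpa using norm_apply_le_singularValues (Matrix.toEuclideanLin P) (EuclideanSpace.single j 1)

/-- Apply the inverse to the image of a unit vector that is contracted most. With the next lemma,
the smallest singular value is the reciprocal of the norm of the inverse, up to a factor `3`. -/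
theorem one_le_singularValues_two_mul {P Q : Matrix (Fin 3) (Fin 3) ℝ} (h : Q * P = 1) :
    1 ≤ (Matrix.toEuclideanLin P).singularValues 2 * (3 * rowNorm Q) := by
  obtain ⟨x, hx, hs⟩ := exists_norm_apply_eq_singularValues (Matrix.toEuclideanLin P) 2
  have := norm_toEuclideanLin_le Q (Matrix.toEuclideanLin P x)
  rw [toEuclideanLin_comp_apply h, hx, hs, mul_comm] at this
  exact this

theorem singularValues_two_mul_rowNorm_le {P Q : Matrix (Fin 3) (Fin 3) ℝ} (h : P * Q = 1)
    (h0 : 0 < (Matrix.toEuclideanLin P).singularValues 2) :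
    (Matrix.toEuclideanLin P).singularValues 2 * rowNorm Q ≤ 3 := by
  rw [← le_div_iff₀' h0]
  refine (rowNorm_le_three_mul (c := 1 / (Matrix.toEuclideanLin P).singularValues 2)
    fun i j => ?_).trans_eq (by ring)
  rw [← toEuclideanLin_single Q i j, le_div_iff₀' h0]
  refine (mul_le_mul_of_nonneg_left (PiLp.norm_apply_le
    (Matrix.toEuclideanLin Q (EuclideanSpace.single j 1)) i) h0.le).trans ?_
  refine (singularValues_mul_norm_le (Matrix.toEuclideanLin P) _).trans ?_
  rw [toEuclideanLin_comp_apply h]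
  simp

theorem singularValues_prod (P : Matrix (Fin 3) (Fin 3) ℝ) :
    (Matrix.toEuclideanLin P).singularValues 0 * (Matrix.toEuclideanLin P).singularValues 1 *
      (Matrix.toEuclideanLin P).singularValues 2 = |P.det| := by
  have h := (Matrix.toEuclideanLin P).normDet_eq_prod_singularValues
  rw [LinearMap.normDet_eq_abs_det, finrank_euclideanSpace_fin] at h
  have hd : LinearMap.det (Matrix.toEuclideanLin P) = P.det := by
    simp [Matrix.toEuclideanLin]
  rw [hd] at h
  rw [h]
  simp [Finset.prod_range_succ]

/-- Bounded multiplicative errors disappear after taking logarithms and dividing by `n`, so the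
choice of norm and a fixed change of basis do not affect the rates. -/
theorem tendsto_log_div_of_le {u v : ℕ → ℝ} {a c : ℝ} (hc : 0 < c) (hu : ∀ n, 0 < u n)
    (hv : ∀ n, 0 < v n) (huv : ∀ n, u n ≤ c * v n) (hvu : ∀ n, v n ≤ c * u n)
    (h : Tendsto (fun n : ℕ => Real.log (v n) / n) atTop (𝓝 a)) :
    Tendsto (fun n : ℕ => Real.log (u n) / n) atTop (𝓝 a) := by
  have h0 := tendsto_const_div_atTop_nhds_zero_nat (Real.log c)
  have hlow : Tendsto (fun n : ℕ => Real.log (v n) / n - Real.log c / n) atTop (𝓝 a) := by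
    simpa using h.sub h0
  have hupp : Tendsto (fun n : ℕ => Real.log (v n) / n + Real.log c / n) atTop (𝓝 a) := by
    simpa using h.add h0
  refine tendsto_of_tendsto_of_tendsto_of_le_of_le hlow hupp (fun n => ?_) fun n => ?_
  · have := Real.log_le_log (hv n) (hvu n)
    rw [Real.log_mul hc.ne' (hu n).ne'] at this
    simp only [← sub_div]
    exact div_le_div_of_nonneg_right (by linarith) n.cast_nonneg
  · have := Real.log_le_log (hu n) (huv n)
    rw [Real.log_mul hc.ne' (hv n).ne'] at this
    simp only [← add_div]
    exact div_le_div_of_nonneg_right (by linarith) n.cast_nonneg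

/-- In dimension three, the growth rates of the norms of unimodular matrices and of their inverses
determine the Lyapunov exponents. -/
theorem hasLyapunovExponents_of_inverse {P Q : ℕ → Matrix (Fin 3) (Fin 3) ℝ} {a b : ℝ}
    (hPQ : ∀ n, P n * Q n = 1) (hdet : ∀ n, |(P n).det| = 1)
    (ha : Tendsto (fun n : ℕ => Real.log (rowNorm (P n)) / n) atTop (𝓝 a))
    (hb : Tendsto (fun n : ℕ => Real.log (rowNorm (Q n)) / n) atTop (𝓝 b)) :
    HasLyapunovExponents P ![a, b - a, -b] ∧ b - a ≤ a := by
  have hQP : ∀ n, Q n * P n = 1 := fun n => mul_eq_one_comm.1 (hPQ n)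
  set s : ℕ → ℕ → ℝ := fun i n => (Matrix.toEuclideanLin (P n)).singularValues i with hs
  have hprod : ∀ n, s 0 n * s 1 n * s 2 n = 1 := fun n => (singularValues_prod _).trans (hdet n)
  have hnn : ∀ i n, 0 ≤ s i n := fun i n => LinearMap.singularValues_nonneg _ _
  have hp0 : ∀ n, 0 < s 0 n := fun n =>
    (hnn 0 n).lt_of_ne' fun h => by simpa [h] using hprod n
  have hp1 : ∀ n, 0 < s 1 n := fun n =>
    (hnn 1 n).lt_of_ne' fun h => by simpa [h] using hprod n
  have hp2 : ∀ n, 0 < s 2 n := fun n =>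
    (hnn 2 n).lt_of_ne' fun h => by simpa [h] using hprod n
  have hP := fun n => rowNorm_pos_of_mul_eq_one (hPQ n)
  have hQ := fun n => rowNorm_pos_of_mul_eq_one (hQP n)
  have h0 : Tendsto (fun n : ℕ => Real.log (s 0 n) / n) atTop (𝓝 a) :=
    tendsto_log_div_of_le three_pos (hp0) hP (fun n => singularValues_zero_le _)
      (fun n => rowNorm_le_singularValues _) ha
  have h2' : Tendsto (fun n : ℕ => Real.log ((s 2 n)⁻¹) / n) atTop (𝓝 b) := by
    refine tendsto_log_div_of_le three_pos (fun n => inv_pos.2 (hp2 n)) hQ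
      (fun n => ?_) (fun n => ?_) hb
    · rw [inv_le_iff_one_le_mul₀' (hp2 n)]
      exact one_le_singularValues_two_mul (hQP n)
    · rw [← div_eq_mul_inv, le_div_iff₀' (hp2 n)]
      exact singularValues_two_mul_rowNorm_le (hPQ n) (hp2 n)
  have h2 : Tendsto (fun n : ℕ => Real.log (s 2 n) / n) atTop (𝓝 (-b)) := by
    refine h2'.neg.congr fun n => ?_
    rw [Real.log_inv, neg_div, neg_neg]
  -- The product of the three singular values is `1`, so the outer two determine the middle one.
  have h1 : Tendsto (fun n : ℕ => Real.log (s 1 n) / n) atTop (𝓝 (b - a)) := by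
    refine (h2'.sub h0).congr fun n => ?_
    have := congrArg Real.log (hprod n)
    rw [Real.log_one, Real.log_mul (mul_pos (hp0 n) (hp1 n)).ne' (hp2 n).ne',
      Real.log_mul (hp0 n).ne' (hp1 n).ne'] at this
    rw [Real.log_inv, ← sub_div]
    congr 1
    linarith
  refine ⟨fun i => ?_, le_of_tendsto_of_tendsto' h1 h0 fun n =>
    div_le_div_of_nonneg_right (Real.log_le_log (hp1 n)
      (LinearMap.singularValues_antitone _ zero_le_one)) n.cast_nonneg⟩
  fin_cases i
  · exact h0
  · exact h1
  · exact h2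

end Matrices

/-! ### The products of the matrices `A₃` and `B₃` -/

section Products

/-- The signed permutation that conjugates the inverse transpose of `A₃ k` to `B₃ k`. -/
def dualityMatrix : Matrix (Fin 3) (Fin 3) ℝ := !![0, 1, 0; 1, 0, 0; 0, 0, -1]

/-- The length cocycle of the accelerated induction in the lengths `(1 - α, α - β, β)`. -/
def lengthMatrix (k : ℕ) : Matrix (Fin 3) (Fin 3) ℝ :=
  !![(k : ℝ) - 1, (k : ℝ), (k : ℝ) - 1; 1, 0, 0; 0, 1, 1]

/-- The change of basis from the lengths `(1 - α, α - β, β)` to `(β, α, 1 - β)`. -/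
def lengthBasis : Matrix (Fin 3) (Fin 3) ℝ := !![0, 0, 1; 0, 1, 1; 1, 1, 0]

/-- The inverse of `lengthBasis`. -/
def lengthBasisInv : Matrix (Fin 3) (Fin 3) ℝ := !![1, -1, 1; -1, 1, 0; 1, 0, 0]

theorem dualityMatrix_mul_self : dualityMatrix * dualityMatrix = 1 := by
  ext i j
  fin_cases i <;> fin_cases j <;>
    simp [dualityMatrix, Matrix.mul_apply, Fin.sum_univ_three]

theorem rowNorm_dualityMatrix_le : rowNorm dualityMatrix ≤ 1 := by
  refine rowNorm_le_iff.2 fun i => ?_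
  fin_cases i <;> simp [dualityMatrix, Fin.sum_univ_three]

theorem A₃_mul_duality (k : ℕ) :
    A₃ k * (dualityMatrix * (B₃ k).transpose * dualityMatrix) = 1 := by
  ext i j
  fin_cases i <;> fin_cases j <;>
    (simp only [Matrix.mul_apply, Fin.sum_univ_three, Matrix.transpose_apply]
     simp [A₃, B₃, dualityMatrix]
     try ring)

theorem det_A₃ (k : ℕ) : (A₃ k).det = -1 := by
  simp [A₃, Matrix.det_fin_three]
  ring

theorem det_B₃ (k : ℕ) : (B₃ k).det = -1 := by
  simp [B₃, Matrix.det_fin_three]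
  ring

/-- `B₃ k` itself does not dominate `A₃ k` entrywise when `k > 1`; in the length coordinates it
becomes a matrix that does. -/
theorem B₃_mul_lengthBasis (k : ℕ) : B₃ k * lengthBasis = lengthBasis * lengthMatrix k := by
  ext i j
  fin_cases i <;> fin_cases j <;>
    simp [B₃, lengthBasis, lengthMatrix, Matrix.mul_apply, Fin.sum_univ_three]

theorem lengthBasis_mul_inv : lengthBasis * lengthBasisInv = 1 := by
  ext i j
  fin_cases i <;> fin_cases j <;>
    simp [lengthBasis, lengthBasisInv, Matrix.mul_apply, Fin.sum_univ_three]

theorem matrixProduct_zero (M : ℕ → Matrix (Fin 3) (Fin 3) ℝ) (k : ℕ → ℕ) :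
    matrixProduct M k 0 = 1 := by
  simp [matrixProduct]

theorem matrixProduct_succ (M : ℕ → Matrix (Fin 3) (Fin 3) ℝ) (k : ℕ → ℕ) (n : ℕ) :
    matrixProduct M k (n + 1) = matrixProduct M k n * M (k n) := by
  simp [matrixProduct, List.range_succ]

theorem abs_det_matrixProduct {M : ℕ → Matrix (Fin 3) (Fin 3) ℝ} (hM : ∀ k, (M k).det = -1)
    (k : ℕ → ℕ) (n : ℕ) : |(matrixProduct M k n).det| = 1 := by
  induction n with
  | zero => simp [matrixProduct_zero]
  | succ n ih => rw [matrixProduct_succ, Matrix.det_mul, abs_mul, ih, hM]; simp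

/-- The transpose of a matrix, conjugated by `dualityMatrix`. -/
def dualize (M : Matrix (Fin 3) (Fin 3) ℝ) : Matrix (Fin 3) (Fin 3) ℝ :=
  dualityMatrix * M.transpose * dualityMatrix

theorem dualize_mul (M N : Matrix (Fin 3) (Fin 3) ℝ) : dualize (M * N) = dualize N * dualize M := by
  have := dualityMatrix_mul_self
  simp only [dualize, Matrix.transpose_mul]
  calc _ = dualityMatrix * N.transpose * 1 * M.transpose * dualityMatrix := by
        simp only [mul_one, mul_assoc]
    _ = _ := by rw [← this]; simp only [mul_assoc]

theorem transpose_dualityMatrix : dualityMatrix.transpose = dualityMatrix := by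
  ext i j
  fin_cases i <;> fin_cases j <;> simp [dualityMatrix]

theorem dualize_dualize (M : Matrix (Fin 3) (Fin 3) ℝ) : dualize (dualize M) = M := by
  simp only [dualize, Matrix.transpose_mul, Matrix.transpose_transpose, transpose_dualityMatrix]
  calc _ = (dualityMatrix * dualityMatrix) * M * (dualityMatrix * dualityMatrix) := by
        simp only [mul_assoc]
    _ = M := by rw [dualityMatrix_mul_self, one_mul, mul_one]

theorem dualize_one : dualize 1 = 1 := by
  simp [dualize, dualityMatrix_mul_self]

theorem rowNorm_dualize_le (M : Matrix (Fin 3) (Fin 3) ℝ) : rowNorm (dualize M) ≤ 3 * rowNorm M := by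
  have h1 := rowNorm_transpose_le M
  have hJ := rowNorm_dualityMatrix_le
  have hJ0 := rowNorm_nonneg dualityMatrix
  have hM := rowNorm_nonneg M.transpose
  calc rowNorm (dualize M)
      ≤ rowNorm (dualityMatrix * M.transpose) * rowNorm dualityMatrix := rowNorm_mul _ _
    _ ≤ rowNorm (dualityMatrix * M.transpose) := mul_le_of_le_one_right (rowNorm_nonneg _) hJ
    _ ≤ rowNorm dualityMatrix * rowNorm M.transpose := rowNorm_mul _ _
    _ ≤ rowNorm M.transpose := mul_le_of_le_one_left hM hJ
    _ ≤ _ := h1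

theorem matrixProduct_A₃_mul_dualize (k : ℕ → ℕ) (n : ℕ) :
    matrixProduct A₃ k n * dualize (matrixProduct B₃ k n) = 1 := by
  induction n with
  | zero => simp [matrixProduct_zero, dualize_one]
  | succ n ih =>
    rw [matrixProduct_succ, matrixProduct_succ, dualize_mul]
    calc _ = matrixProduct A₃ k n * (A₃ (k n) * dualize (B₃ (k n))) *
          dualize (matrixProduct B₃ k n) := by simp only [mul_assoc]
      _ = 1 := by
        rw [dualize, A₃_mul_duality, mul_one]
        exact ih

theorem matrixProduct_B₃_mul_dualize (k : ℕ → ℕ) (n : ℕ) :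
    matrixProduct B₃ k n * dualize (matrixProduct A₃ k n) = 1 := by
  have := congrArg dualize (matrixProduct_A₃_mul_dualize k n)
  rwa [dualize_mul, dualize_dualize, dualize_one] at this

theorem matrixProduct_B₃_mul_lengthBasis (k : ℕ → ℕ) (n : ℕ) :
    matrixProduct B₃ k n * lengthBasis = lengthBasis * matrixProduct lengthMatrix k n := by
  induction n with
  | zero => simp [matrixProduct_zero]
  | succ n ih =>
    rw [matrixProduct_succ, matrixProduct_succ, mul_assoc, B₃_mul_lengthBasis, ← mul_assoc, ih,
      mul_assoc]

theorem tendsto_log_rowNorm_dualize {P : ℕ → Matrix (Fin 3) (Fin 3) ℝ} {a : ℝ}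
    (hP : ∀ n, 0 < rowNorm (P n)) (hP' : ∀ n, 0 < rowNorm (dualize (P n)))
    (h : Tendsto (fun n : ℕ => Real.log (rowNorm (P n)) / n) atTop (𝓝 a)) :
    Tendsto (fun n : ℕ => Real.log (rowNorm (dualize (P n))) / n) atTop (𝓝 a) := by
  refine tendsto_log_div_of_le three_pos hP' hP (fun n => rowNorm_dualize_le _) (fun n => ?_) h
  have := rowNorm_dualize_le (dualize (P n))
  rwa [dualize_dualize] at this

/-- The exponents of the products of `B₃` and of `A₃` are opposite, and determined by the growth of
the norms of the products of `A₃` and of `lengthMatrix`. -/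
theorem hasLyapunovExponents_A₃_B₃ {k : ℕ → ℕ} {a b : ℝ}
    (ha : Tendsto (fun n : ℕ => Real.log (rowNorm (matrixProduct A₃ k n)) / n) atTop (𝓝 a))
    (hb : Tendsto (fun n : ℕ => Real.log (rowNorm (matrixProduct lengthMatrix k n)) / n) atTop
      (𝓝 b)) :
    HasLyapunovExponents (matrixProduct A₃ k) ![a, b - a, -b] ∧
      HasLyapunovExponents (matrixProduct B₃ k) ![b, a - b, -a] ∧ b - a ≤ a := by
  have hAB := matrixProduct_A₃_mul_dualize k
  have hBA := matrixProduct_B₃_mul_dualize k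
  have hA0 := fun n => rowNorm_pos_of_mul_eq_one (hAB n)
  have hB0 := fun n => rowNorm_pos_of_mul_eq_one (hBA n)
  have hA1 := fun n => rowNorm_pos_of_mul_eq_one (mul_eq_one_comm.1 (hBA n))
  have hB1 := fun n => rowNorm_pos_of_mul_eq_one (mul_eq_one_comm.1 (hAB n))
  set S := lengthBasis
  set S' := lengthBasisInv
  have hSS : S * S' = 1 := lengthBasis_mul_inv
  have hSS' : S' * S = 1 := mul_eq_one_comm.1 hSS
  have hBL : ∀ n, matrixProduct B₃ k n = S * matrixProduct lengthMatrix k n * S' := fun n => by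
    rw [← matrixProduct_B₃_mul_lengthBasis, mul_assoc, hSS, mul_one]
  have hLB : ∀ n, matrixProduct lengthMatrix k n = S' * matrixProduct B₃ k n * S := fun n => by
    rw [mul_assoc, matrixProduct_B₃_mul_lengthBasis, ← mul_assoc, hSS', one_mul]
  have hS := rowNorm_pos_of_mul_eq_one hSS
  have hS' := rowNorm_pos_of_mul_eq_one hSS'
  have hle : ∀ U M V : Matrix (Fin 3) (Fin 3) ℝ,
      rowNorm (U * M * V) ≤ rowNorm U * rowNorm M * rowNorm V := fun U M V =>
    (rowNorm_mul _ _).trans (mul_le_mul_of_nonneg_right (rowNorm_mul _ _) (rowNorm_nonneg V))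
  have hBL' : ∀ n, rowNorm (matrixProduct B₃ k n) ≤
      rowNorm S * rowNorm S' * rowNorm (matrixProduct lengthMatrix k n) := fun n => by
    rw [hBL]
    exact (hle _ _ _).trans_eq (by ring)
  have hLB' : ∀ n, rowNorm (matrixProduct lengthMatrix k n) ≤
      rowNorm S * rowNorm S' * rowNorm (matrixProduct B₃ k n) := fun n => by
    rw [hLB]
    exact (hle _ _ _).trans_eq (by ring)
  have hL0 : ∀ n, 0 < rowNorm (matrixProduct lengthMatrix k n) := fun n =>
    pos_of_mul_pos_right ((hB0 n).trans_le (hBL' n)) (mul_pos hS hS').le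
  have hb' : Tendsto (fun n : ℕ => Real.log (rowNorm (matrixProduct B₃ k n)) / n) atTop (𝓝 b) :=
    tendsto_log_div_of_le (mul_pos hS hS') hB0 hL0 hBL' hLB' hb
  have hA := hasLyapunovExponents_of_inverse hAB (abs_det_matrixProduct det_A₃ k) ha
    (tendsto_log_rowNorm_dualize hB0 hB1 hb')
  have hB := hasLyapunovExponents_of_inverse hBA (abs_det_matrixProduct det_B₃ k) hb'
    (tendsto_log_rowNorm_dualize hA0 hA1 ha)
  exact ⟨hA.1, hB.1, hA.2⟩

end Products

/-! ### Nonnegative matrix cocycles -/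

section Cocycles

/-- A nonnegative matrix whose row sums are at least `1`. -/
structure RowExpanding (M : Matrix (Fin 3) (Fin 3) ℝ) : Prop where
  nonneg : ∀ i j, 0 ≤ M i j
  one_le_sum : ∀ i, 1 ≤ ∑ j, M i j

namespace RowExpanding

variable {M N : Matrix (Fin 3) (Fin 3) ℝ}

theorem one : RowExpanding 1 where
  nonneg i j := by
    rw [Matrix.one_apply]
    split_ifs <;> simp
  one_le_sum i := by simp [Matrix.one_apply]

theorem mul (hM : RowExpanding M) (hN : RowExpanding N) : RowExpanding (M * N) where
  nonneg i j := by
    rw [Matrix.mul_apply]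
    exact Finset.sum_nonneg fun l _ => mul_nonneg (hM.nonneg i l) (hN.nonneg l j)
  one_le_sum i := by
    simp only [Matrix.mul_apply]
    rw [Finset.sum_comm]
    simp only [← Finset.mul_sum]
    exact (hM.one_le_sum i).trans (Finset.sum_le_sum fun l _ =>
      le_mul_of_one_le_right (hM.nonneg i l) (hN.one_le_sum l))

theorem one_le_rowNorm (hM : RowExpanding M) : 1 ≤ rowNorm M := by
  refine (hM.one_le_sum 0).trans (le_trans ?_ (sum_abs_le_rowNorm M 0))
  exact Finset.sum_le_sum fun j _ => le_abs_self _

end RowExpanding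

/-- The maximal ratio of corresponding entries of two matrices. -/
noncomputable def entryRatio (M N : Matrix (Fin 3) (Fin 3) ℝ) : ℝ :=
  Finset.univ.sup' Finset.univ_nonempty fun p : Fin 3 × Fin 3 => M p.1 p.2 / N p.1 p.2

section entryRatio

variable {M N M' N' : Matrix (Fin 3) (Fin 3) ℝ}

theorem div_le_entryRatio (M N : Matrix (Fin 3) (Fin 3) ℝ) (i j : Fin 3) :
    M i j / N i j ≤ entryRatio M N :=
  Finset.le_sup' (fun p : Fin 3 × Fin 3 => M p.1 p.2 / N p.1 p.2) (Finset.mem_univ (i, j))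

theorem entryRatio_nonneg (hM : ∀ i j, 0 ≤ M i j) (hN : ∀ i j, 0 ≤ N i j) :
    0 ≤ entryRatio M N :=
  (div_nonneg (hM 0 0) (hN 0 0)).trans (div_le_entryRatio M N 0 0)

/-- Where `N i j = 0`, the quotient is `0` by convention and carries no information; there the
domination itself gives `M i j = 0`. -/
theorem le_entryRatio_mul (hM : ∀ i j, 0 ≤ M i j) (hMN : ∀ i j, M i j ≤ N i j) (i j : Fin 3) :
    M i j ≤ entryRatio M N * N i j := by
  rcases ((hM i j).trans (hMN i j)).eq_or_lt with h | h
  · rw [← h, mul_zero, h]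
    exact hMN i j
  · rw [← div_le_iff₀ h]
    exact div_le_entryRatio M N i j

theorem entryRatio_le {c : ℝ} (hN : ∀ i j, 0 ≤ N i j) (hc : 0 ≤ c)
    (h : ∀ i j, M i j ≤ c * N i j) : entryRatio M N ≤ c :=
  Finset.sup'_le _ _ fun _ _ => div_le_of_le_mul₀ (hN _ _) hc (h _ _)

theorem entryRatio_lt_one (hM : ∀ i j, 0 ≤ M i j) (h : ∀ i j, M i j < N i j) :
    entryRatio M N < 1 :=
  (Finset.sup'_lt_iff _).2 fun _ _ => (div_lt_one ((hM _ _).trans_lt (h _ _))).2 (h _ _)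

theorem rowNorm_le_entryRatio_mul (hM : ∀ i j, 0 ≤ M i j) (hMN : ∀ i j, M i j ≤ N i j) :
    rowNorm M ≤ entryRatio M N * rowNorm N := by
  have hN : ∀ i j, 0 ≤ N i j := fun i j => (hM i j).trans (hMN i j)
  refine rowNorm_le_mul (fun i j => ?_) (entryRatio_nonneg hM hN)
  rw [abs_of_nonneg (hM i j), abs_of_nonneg (hN i j)]
  exact le_entryRatio_mul hM hMN i j

/-- Entrywise bounds `M ≤ θ N` and `M' ≤ θ' N'` between nonnegative matrices multiply. This is the
subadditivity of the logarithm of the ratio. -/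
theorem entryRatio_mul_le (hM : ∀ i j, 0 ≤ M i j) (hMN : ∀ i j, M i j ≤ N i j)
    (hM' : ∀ i j, 0 ≤ M' i j) (hMN' : ∀ i j, M' i j ≤ N' i j) :
    entryRatio (M * M') (N * N') ≤ entryRatio M N * entryRatio M' N' := by
  have hN : ∀ i j, 0 ≤ N i j := fun i j => (hM i j).trans (hMN i j)
  have hN' : ∀ i j, 0 ≤ N' i j := fun i j => (hM' i j).trans (hMN' i j)
  have h := entryRatio_nonneg hM hN
  refine entryRatio_le (fun i j => ?_) (mul_nonneg h (entryRatio_nonneg hM' hN')) fun i j => ?_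
  · rw [Matrix.mul_apply]
    exact Finset.sum_nonneg fun l _ => mul_nonneg (hN i l) (hN' l j)
  · rw [Matrix.mul_apply, Matrix.mul_apply, Finset.mul_sum]
    refine Finset.sum_le_sum fun l _ => ?_
    refine (mul_le_mul (le_entryRatio_mul hM hMN i l) (le_entryRatio_mul hM' hMN' l j) (hM' l j)
      (mul_nonneg h (hN i l))).trans_eq (by ring)

end entryRatio

/-! ### Cocycles over a map and their growth rates -/

variable {X : Type*} {T : X → X}
  {M N : X → Matrix (Fin 3) (Fin 3) ℝ}

/-- The cocycle `M x * M (T x) * ⋯ * M (T^[n - 1] x)`. -/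
def cocycle {X : Type*} (T : X → X) (M : X → Matrix (Fin 3) (Fin 3) ℝ) :
    ℕ → X → Matrix (Fin 3) (Fin 3) ℝ
  | 0, _ => 1
  | n + 1, x => M x * cocycle T M n (T x)

theorem cocycle_add (m n : ℕ) (x : X) :
    cocycle T M (m + n) x = cocycle T M m x * cocycle T M n (T^[m] x) := by
  induction m generalizing x with
  | zero => simp [cocycle]
  | succ m ih =>
    rw [show m + 1 + n = (m + n) + 1 by ring, cocycle, cocycle, ih, mul_assoc,
      Function.iterate_succ_apply]

theorem rowExpanding_cocycle (hM : ∀ x, RowExpanding (M x)) (n : ℕ) (x : X) :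
    RowExpanding (cocycle T M n x) := by
  induction n generalizing x with
  | zero => exact .one
  | succ n ih => exact (hM x).mul (ih _)

theorem cocycle_mono (hM : ∀ x, RowExpanding (M x)) (hN : ∀ x, RowExpanding (N x))
    (hMN : ∀ x i j, M x i j ≤ N x i j) (n : ℕ) (x : X) (i j : Fin 3) :
    cocycle T M n x i j ≤ cocycle T N n x i j := by
  induction n generalizing x i j with
  | zero => exact le_rfl
  | succ n ih =>
    simp only [cocycle, Matrix.mul_apply]
    exact Finset.sum_le_sum fun l _ => mul_le_mul (hMN x i l) (ih _ _ _)
      ((rowExpanding_cocycle hM n _).nonneg _ _) ((hN x).nonneg _ _)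

theorem rowNorm_cocycle_le {K : ℝ} (hK : ∀ x, rowNorm (M x) ≤ K) (n : ℕ) (x : X) :
    rowNorm (cocycle T M n x) ≤ K ^ n := by
  induction n generalizing x with
  | zero => simp [cocycle, rowNorm_one]
  | succ n ih =>
    rw [cocycle, pow_succ']
    exact (rowNorm_mul _ _).trans (mul_le_mul (hK x) (ih _) (rowNorm_nonneg _)
      ((rowNorm_nonneg _).trans (hK x)))

/-- The smaller product has norm at least `1` and the larger one at most `K ^ n`. This keeps the
logarithm of the ratio from decreasing faster than linearly. -/
theorem pow_inv_le_entryRatio {K : ℝ} (hM : ∀ x, RowExpanding (M x))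
    (hN : ∀ x, RowExpanding (N x)) (hMN : ∀ x i j, M x i j ≤ N x i j)
    (hK : ∀ x, rowNorm (N x) ≤ K) (n : ℕ) (x : X) :
    (K ^ n)⁻¹ ≤ entryRatio (cocycle T M n x) (cocycle T N n x) := by
  have hK0 : 0 < K := one_pos.trans_le ((hN x).one_le_rowNorm.trans (hK x))
  rw [inv_le_iff_one_le_mul₀ (pow_pos hK0 n)]
  have h1 := rowExpanding_cocycle (T := T) hM n x
  refine h1.one_le_rowNorm.trans ((rowNorm_le_entryRatio_mul h1.nonneg
    (cocycle_mono hM hN hMN n x)).trans ?_)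
  exact mul_le_mul_of_nonneg_left (rowNorm_cocycle_le hK n x)
    (entryRatio_nonneg h1.nonneg (rowExpanding_cocycle hN n x).nonneg)

theorem entryRatio_cocycle_le_one (hM : ∀ x, RowExpanding (M x))
    (hN : ∀ x, RowExpanding (N x)) (hMN : ∀ x i j, M x i j ≤ N x i j) (n : ℕ) (x : X) :
    entryRatio (cocycle T M n x) (cocycle T N n x) ≤ 1 :=
  entryRatio_le (rowExpanding_cocycle hN n x).nonneg zero_le_one fun i j => by
    rw [one_mul]; exact cocycle_mono hM hN hMN n x i j

variable [MeasurableSpace X] {μ : Measure X}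

theorem measurable_cocycle (hT : Measurable T) (hM : ∀ i j, Measurable fun x => M x i j) (n : ℕ) :
    ∀ i j, Measurable fun x => cocycle T M n x i j := by
  induction n with
  | zero => exact fun i j => measurable_const
  | succ n ih =>
    intro i j
    simp only [cocycle, Matrix.mul_apply]
    exact Finset.measurable_sum _ fun l _ => (hM i l).mul ((ih l j).comp hT)

theorem isBoundedSubadditive_log_rowNorm {K : ℝ} (hT : Measurable T)
    (hMm : ∀ i j, Measurable fun x => M x i j) (hM : ∀ x, RowExpanding (M x))
    (hK : ∀ x, rowNorm (M x) ≤ K) :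
    IsBoundedSubadditive T (fun n x => Real.log (rowNorm (cocycle T M n x))) (Real.log K) := by
  have h1 : ∀ n x, 1 ≤ rowNorm (cocycle T M n x) := fun n x =>
    (rowExpanding_cocycle hM n x).one_le_rowNorm
  refine ⟨fun n => Real.measurable_log.comp ?_, fun n x => ?_, fun m n x => ?_⟩
  · convert Finset.measurable_sup' Finset.univ_nonempty fun i _ =>
      Finset.measurable_sum Finset.univ fun j _ =>
        continuous_abs.measurable.comp (measurable_cocycle hT hMm n i j) using 1
    ext x
    simp [rowNorm]
  · rw [abs_of_nonneg (Real.log_nonneg (h1 n x)), mul_comm, ← Real.log_pow]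
    exact Real.log_le_log (one_pos.trans_le (h1 n x)) (rowNorm_cocycle_le hK n x)
  · rw [cocycle_add, ← Real.log_mul (one_pos.trans_le (h1 _ _)).ne' (one_pos.trans_le (h1 _ _)).ne']
    refine Real.log_le_log ?_ (rowNorm_mul _ _)
    rw [← cocycle_add]
    exact one_pos.trans_le (h1 _ _)

theorem isBoundedSubadditive_log_entryRatio {K : ℝ} (hT : Measurable T)
    (hMm : ∀ i j, Measurable fun x => M x i j) (hNm : ∀ i j, Measurable fun x => N x i j)
    (hM : ∀ x, RowExpanding (M x)) (hN : ∀ x, RowExpanding (N x))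
    (hMN : ∀ x i j, M x i j ≤ N x i j) (hK0 : 0 < K) (hK : ∀ x, rowNorm (N x) ≤ K) :
    IsBoundedSubadditive T
      (fun n x => Real.log (entryRatio (cocycle T M n x) (cocycle T N n x))) (Real.log K) := by
  have hpos : ∀ n x, 0 < entryRatio (cocycle T M n x) (cocycle T N n x) := fun n x =>
    (inv_pos.2 (pow_pos hK0 n)).trans_le (pow_inv_le_entryRatio hM hN hMN hK n x)
  refine ⟨fun n => Real.measurable_log.comp ?_, fun n x => ?_, fun m n x => ?_⟩
  · convert Finset.measurable_sup' Finset.univ_nonempty fun (p : Fin 3 × Fin 3) _ =>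
      (measurable_cocycle hT hMm n p.1 p.2).div (measurable_cocycle hT hNm n p.1 p.2) using 1
    ext x
    simp [entryRatio]
  · rw [abs_of_nonpos (Real.log_nonpos (hpos n x).le (entryRatio_cocycle_le_one hM hN hMN n x)),
      neg_le, mul_comm, ← Real.log_pow, ← Real.log_inv]
    exact Real.log_le_log (inv_pos.2 (pow_pos hK0 n)) (pow_inv_le_entryRatio hM hN hMN hK n x)
  · rw [← Real.log_mul (hpos _ _).ne' (hpos _ _).ne']
    refine Real.log_le_log (hpos _ _) ?_
    rw [cocycle_add, cocycle_add]
    exact entryRatio_mul_le (rowExpanding_cocycle hM m x).nonneg (cocycle_mono hM hN hMN m x)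
      (rowExpanding_cocycle hM n _).nonneg (cocycle_mono hM hN hMN n _)

/-- Two nonnegative cocycles, one dominated by the other, have growth rates almost everywhere, and
these are different along the orbits on which all entries of the products become different. -/
theorem ae_exists_growth_lt [IsFiniteMeasure μ] {K : ℝ} (hT : MeasurePreserving T μ μ)
    (hMm : ∀ i j, Measurable fun x => M x i j) (hNm : ∀ i j, Measurable fun x => N x i j)
    (hM : ∀ x, RowExpanding (M x)) (hN : ∀ x, RowExpanding (N x))
    (hMN : ∀ x i j, M x i j ≤ N x i j) (hK0 : 0 < K) (hKM : ∀ x, rowNorm (M x) ≤ K)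
    (hKN : ∀ x, rowNorm (N x) ≤ K) :
    ∀ᵐ x ∂μ, ∃ a b : ℝ,
      Tendsto (fun n : ℕ => Real.log (rowNorm (cocycle T M n x)) / n) atTop (𝓝 a) ∧
      Tendsto (fun n : ℕ => Real.log (rowNorm (cocycle T N n x)) / n) atTop (𝓝 b) ∧
      ((∃ n, ∀ i j, cocycle T M n x i j < cocycle T N n x i j) → a < b) := by
  have hA := isBoundedSubadditive_log_rowNorm hT.measurable hMm hM hKM
  have hB := isBoundedSubadditive_log_rowNorm hT.measurable hNm hN hKN
  have hR := isBoundedSubadditive_log_entryRatio hT.measurable hMm hNm hM hN hMN hK0 hKN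
  have hpos : ∀ n x, 0 < entryRatio (cocycle T M n x) (cocycle T N n x) := fun n x =>
    (inv_pos.2 (pow_pos hK0 n)).trans_le (pow_inv_le_entryRatio hM hN hMN hKN n x)
  have hR0 : ∀ n x, Real.log (entryRatio (cocycle T M n x) (cocycle T N n x)) ≤ 0 := fun n x =>
    Real.log_nonpos (hpos n x).le (entryRatio_cocycle_le_one hM hN hMN n x)
  filter_upwards [IsBoundedSubadditive.ae_tendsto hT hA, IsBoundedSubadditive.ae_tendsto hT hB,
    IsBoundedSubadditive.ae_tendsto hT hR, IsBoundedSubadditive.ae_upper_neg hT hR hR0]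
    with x ha hb hr hneg
  refine ⟨_, _, ha, hb, fun ⟨n, hn⟩ => ?_⟩
  have h1 := hneg ⟨n, Real.log_neg (hpos n x)
    (entryRatio_lt_one (rowExpanding_cocycle hM n x).nonneg hn)⟩
  -- The norm of the smaller product is at most the ratio times that of the larger one, so `a` is at
  -- most `b` plus a negative rate.
  refine lt_of_le_of_lt (le_of_tendsto_of_tendsto' ha (hr.add hb) fun n => ?_)
    (by linarith : _ < _)
  have hM1 := rowExpanding_cocycle (T := T) hM n x
  have hN1 := (rowExpanding_cocycle (T := T) hN n x).one_le_rowNorm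
  rw [← add_div, ← Real.log_mul (hpos n x).ne' (one_pos.trans_le hN1).ne']
  exact div_le_div_of_nonneg_right (Real.log_le_log (one_pos.trans_le hM1.one_le_rowNorm)
    (rowNorm_le_entryRatio_mul hM1.nonneg (cocycle_mono hM hN hMN n x))) n.cast_nonneg

end Cocycles

/-! ### Comparison of the products of `A₃` and of `lengthMatrix` -/

section Comparison

/-- If a row of the product of the `A₃ (k i)` is `(a, b, c)` and the same row of the product of the
`lengthMatrix (k i)` exceeds it by `(d, e, f)`, then `d`, `e` and `f` are eventually positive. -/
theorem eventually_excess_pos {k : ℕ → ℕ} (hk : ∀ n, 1 ≤ k n)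
    (hk2 : ∀ n, ∃ t, 1 < k (n + 2 * t)) {a b c d e f : ℕ → ℝ}
    (ha : ∀ n, 0 ≤ a n) (hc : ∀ n, 0 ≤ c n)
    (hd : ∀ n, 0 ≤ d n) (he : ∀ n, 0 ≤ e n) (hf : ∀ n, 0 ≤ f n)
    (ha' : ∀ n, a (n + 1) = b n) (hb' : ∀ n, b (n + 1) = k n * a n + c n)
    (hd' : ∀ n, d (n + 1) = (k n - 1) * (a n + d n) + e n)
    (he' : ∀ n, e (n + 1) = k n * d n + f n)
    (hf' : ∀ n, f (n + 1) = (k n - 1) * d n + f n)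
    (h0 : 0 < a 0 + b 0 + c 0) :
    ∀ᶠ n in atTop, 0 < d n ∧ 0 < e n ∧ 0 < f n := by
  have hk' : ∀ n, (1 : ℝ) ≤ k n := fun n => by exact_mod_cast hk n
  have hkn : ∀ n, 0 ≤ (k n : ℝ) - 1 := fun n => sub_nonneg.2 (hk' n)
  have hkp : ∀ n, (0 : ℝ) < k n := fun n => one_pos.trans_le (hk' n)
  -- Since `a 1 = b 0` and `a 2 = k 0 * a 0 + c 0`, vanishing of `a` at the times `0, 1, 2` would
  -- make the initial row zero.
  obtain ⟨m, hm⟩ : ∃ m, 0 < a m := by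
    by_contra! hcon
    have h1 := hcon 0
    have h2 := hcon 1
    have h3 := hcon 2
    rw [ha'] at h2 h3
    rw [hb'] at h3
    nlinarith [mul_nonneg (hkp 0).le (ha 0)]
  -- Positivity of `a` propagates only by two steps at a time, which is why digits exceeding `1` are
  -- needed in each parity class.
  have ha2 : ∀ t, 0 < a (m + 2 * t) := by
    intro t
    induction t with
    | zero => exact hm
    | succ t ih =>
      rw [show m + 2 * (t + 1) = m + 2 * t + 1 + 1 by ring, ha', hb']
      linarith [mul_pos (hkp (m + 2 * t)) ih, hc (m + 2 * t)]
  obtain ⟨t, ht⟩ := hk2 m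
  have ht' : (0 : ℝ) < k (m + 2 * t) - 1 := by
    rw [sub_pos]; exact_mod_cast ht
  obtain ⟨l, hl⟩ : ∃ l, 0 < d l := by
    refine ⟨m + 2 * t + 1, ?_⟩
    rw [hd']
    linarith [mul_pos ht' (add_pos_of_pos_of_nonneg (ha2 t) (hd (m + 2 * t))), he (m + 2 * t)]
  have hd2 : ∀ s, 0 < d (l + 2 * s) := by
    intro s
    induction s with
    | zero => exact hl
    | succ s ih =>
      rw [show l + 2 * (s + 1) = l + 2 * s + 1 + 1 by ring, hd', he']
      have h1 := mul_pos (hkp (l + 2 * s)) ih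
      have h2 := mul_nonneg (hkn (l + 2 * s + 1))
        (add_nonneg (ha (l + 2 * s + 1)) (hd (l + 2 * s + 1)))
      linarith [hf (l + 2 * s)]
  -- A second digit exceeding `1`, now at a time when `d` is positive, feeds `f`. From then on `f`
  -- stays positive, `e` follows one step later and `d` two steps later.
  obtain ⟨s, hs⟩ := hk2 l
  have hs' : (0 : ℝ) < k (l + 2 * s) - 1 := by
    rw [sub_pos]; exact_mod_cast hs
  set N := l + 2 * s + 1 with hN
  have hfN : ∀ n, 0 < f (N + n) := by
    intro n
    induction n with
    | zero =>
      rw [add_zero, hN, hf']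
      linarith [mul_pos hs' (hd2 s), hf (l + 2 * s)]
    | succ n ih =>
      rw [← add_assoc, hf']
      linarith [mul_nonneg (hkn (N + n)) (hd (N + n))]
  have heN : ∀ n, 0 < e (N + n + 1) := by
    intro n
    rw [he']
    linarith [mul_nonneg (hkp (N + n)).le (hd (N + n)), hfN n]
  have hdN : ∀ n, 0 < d (N + n + 1 + 1) := by
    intro n
    rw [hd']
    linarith [mul_nonneg (hkn (N + n + 1)) (add_nonneg (ha (N + n + 1)) (hd (N + n + 1))), heN n]
  filter_upwards [eventually_ge_atTop (N + 2)] with n hn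
  obtain ⟨r, rfl⟩ := Nat.exists_eq_add_of_le hn
  refine ⟨?_, ?_, ?_⟩
  · convert hdN r using 2; ring
  · convert heN (r + 1) using 2; ring
  · convert hfN (r + 2) using 2; ring

theorem rowExpanding_A₃ {k : ℕ} (hk : 1 ≤ k) : RowExpanding (A₃ k) := by
  have h1 : (1 : ℝ) ≤ k := by exact_mod_cast hk
  constructor
  · intro i j
    fin_cases i <;> fin_cases j <;> (simp [A₃]; try linarith)
  · intro i
    fin_cases i <;> (simp [A₃, Fin.sum_univ_three]; try linarith)

theorem rowExpanding_matrixProduct {M : ℕ → Matrix (Fin 3) (Fin 3) ℝ} {k : ℕ → ℕ}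
    (hM : ∀ n, RowExpanding (M (k n))) (n : ℕ) : RowExpanding (matrixProduct M k n) := by
  induction n with
  | zero => rw [matrixProduct_zero]; exact .one
  | succ n ih => rw [matrixProduct_succ]; exact ih.mul (hM n)

theorem A₃_le_lengthMatrix {k : ℕ} (hk : 1 ≤ k) (i j : Fin 3) : A₃ k i j ≤ lengthMatrix k i j := by
  have h1 : (1 : ℝ) ≤ k := by exact_mod_cast hk
  fin_cases i <;> fin_cases j <;> simp [A₃, lengthMatrix]
  linarith

theorem matrixProduct_A₃_le {k : ℕ → ℕ} (hk : ∀ n, 1 ≤ k n) (n : ℕ) (i j : Fin 3) :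
    matrixProduct A₃ k n i j ≤ matrixProduct lengthMatrix k n i j := by
  induction n generalizing i j with
  | zero => simp [matrixProduct_zero]
  | succ n ih =>
    have hA : ∀ n, RowExpanding (A₃ (k n)) := fun n => rowExpanding_A₃ (hk n)
    have h1 := rowExpanding_matrixProduct hA n
    simp only [matrixProduct_succ, Matrix.mul_apply]
    exact Finset.sum_le_sum fun l _ => mul_le_mul (ih i l) (A₃_le_lengthMatrix (hk n) l j)
      ((hA n).nonneg l j) ((h1.nonneg i l).trans (ih i l))

/-- If the digits exceed `1` infinitely often along both parities, then all entries of the products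
of the `A₃` and of the `lengthMatrix` become different. -/
theorem exists_matrixProduct_A₃_lt {k : ℕ → ℕ} (hk : ∀ n, 1 ≤ k n)
    (hk2 : ∀ n, ∃ t, 1 < k (n + 2 * t)) :
    ∃ n, ∀ i j, matrixProduct A₃ k n i j < matrixProduct lengthMatrix k n i j := by
  set P := matrixProduct A₃ k
  set Q := matrixProduct lengthMatrix k
  have hP : ∀ n, RowExpanding (P n) := rowExpanding_matrixProduct fun n => rowExpanding_A₃ (hk n)
  have hPQ : ∀ n i j, 0 ≤ Q n i j - P n i j := fun n i j =>
    sub_nonneg.2 (matrixProduct_A₃_le hk n i j)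
  have hPs : ∀ n, P (n + 1) = P n * A₃ (k n) := matrixProduct_succ A₃ k
  have hQs : ∀ n, Q (n + 1) = Q n * lengthMatrix (k n) := matrixProduct_succ lengthMatrix k
  have h : ∀ i, ∀ᶠ n in atTop, 0 < Q n i 0 - P n i 0 ∧ 0 < Q n i 1 - P n i 1 ∧
      0 < Q n i 2 - P n i 2 := by
    intro i
    refine eventually_excess_pos hk hk2 (a := fun n => P n i 0) (b := fun n => P n i 1)
      (c := fun n => P n i 2) (fun n => (hP n).nonneg _ _) (fun n => (hP n).nonneg _ _)
      (fun n => hPQ n _ _) (fun n => hPQ n _ _) (fun n => hPQ n _ _)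
      ?_ ?_ ?_ ?_ ?_ ?_
    · intro n
      simp [hPs, A₃, Matrix.mul_apply, Fin.sum_univ_three]
    · intro n
      simp [hPs, A₃, Matrix.mul_apply, Fin.sum_univ_three]
      ring
    · intro n
      simp [hPs, hQs, A₃, lengthMatrix, Matrix.mul_apply, Fin.sum_univ_three]
      ring
    · intro n
      simp [hPs, hQs, A₃, lengthMatrix, Matrix.mul_apply, Fin.sum_univ_three]
      ring
    · intro n
      simp [hPs, hQs, A₃, lengthMatrix, Matrix.mul_apply, Fin.sum_univ_three]
      ring
    · have := (hP 0).one_le_sum i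
      rw [Fin.sum_univ_three] at this
      linarith
  obtain ⟨n, h0, h1, h2⟩ := ((h 0).and ((h 1).and (h 2))).exists
  refine ⟨n, fun i j => sub_pos.1 ?_⟩
  fin_cases i <;> fin_cases j <;> simp_all

end Comparison

/-! ### From the induction to its acceleration -/

section Acceleration

/-- The unipotent factor of `A₃`: `A₃ (k + 1) = shearA * A₃ k`. -/
def shearA : Matrix (Fin 3) (Fin 3) ℝ := !![1, 0, 1; 0, 1, 0; 0, 0, 1]

/-- The unipotent factor of `lengthMatrix`. -/
def shearL : Matrix (Fin 3) (Fin 3) ℝ := !![1, 1, 1; 0, 1, 0; 0, 0, 1]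

/-- The matrix `U` in the first case of the induction, and `C` in the second one. -/
noncomputable def btStep (U C : Matrix (Fin 3) (Fin 3) ℝ) (p : ℝ × ℝ) : Matrix (Fin 3) (Fin 3) ℝ :=
  if p.1 ≤ 1 / 2 then U else C

theorem measurable_btStep (U C : Matrix (Fin 3) (Fin 3) ℝ) (i j : Fin 3) :
    Measurable fun p => btStep U C p i j := by
  have : (fun p => btStep U C p i j) = fun p : ℝ × ℝ => if p.1 ≤ 1 / 2 then U i j else C i j := by
    ext p
    simp only [btStep]
    split_ifs <;> rfl
  rw [this]
  exact Measurable.ite (measurableSet_le measurable_fst measurable_const) measurable_const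
    measurable_const

theorem shearA_mul (k : ℕ) : shearA * A₃ k = A₃ (k + 1) := by
  ext i j
  fin_cases i <;> fin_cases j <;> simp [shearA, A₃, Matrix.mul_apply, Fin.sum_univ_three]

theorem shearL_mul (k : ℕ) : shearL * lengthMatrix k = lengthMatrix (k + 1) := by
  ext i j
  fin_cases i <;> fin_cases j <;> simp [shearL, lengthMatrix, Matrix.mul_apply, Fin.sum_univ_three]

/-- Minus the indicator of the second case of the induction. -/
noncomputable def negVisit (p : ℝ × ℝ) : ℝ := if p.1 ≤ 1 / 2 then 0 else -1

theorem isBoundedSubadditive_birkhoffSum_negVisit (hR : Measurable btInduction) :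
    IsBoundedSubadditive btInduction (birkhoffSum btInduction negVisit) 1 where
  measurable n := Finset.measurable_sum _ fun i _ =>
    (Measurable.ite (measurableSet_le measurable_fst measurable_const) measurable_const
      measurable_const).comp (hR.iterate i)
  bound n p := by
    refine (Finset.abs_sum_le_sum_abs _ _).trans
      ((Finset.sum_le_card_nsmul _ _ 1 fun i _ => ?_).trans_eq (by simp))
    unfold negVisit
    split_ifs <;> simp
  subadd m n p := (birkhoffSum_add _ _ _ _ _).le

theorem birkhoffSum_negVisit_nonpos (n : ℕ) (p : ℝ × ℝ) :
    birkhoffSum btInduction negVisit n p ≤ 0 :=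
  Finset.sum_nonpos fun i _ => by
    unfold negVisit
    split_ifs <;> simp

/-- The parameters whose orbit under the induction stays in the triangle. -/
def btRegular : Set (ℝ × ℝ) := {p | ∀ n, btInduction^[n] p ∈ btTriangle}

theorem iterate_mem_btRegular {p : ℝ × ℝ} (hp : p ∈ btRegular) (n : ℕ) :
    btInduction^[n] p ∈ btRegular := fun m => by
  rw [← Function.iterate_add_apply]; exact hp _

theorem ae_btRegular {μ : Measure (ℝ × ℝ)} (hμ : IsBTMeasure μ) : ∀ᵐ p ∂μ, p ∈ btRegular := by
  refine ae_all_iff.2 fun n => (hμ.invariant.iterate n).quasiMeasurePreserving.ae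
    (hμ.ae_infiniteType.mono fun p hp => hp.1)

/-- The first digit of a parameter is `1` in the second case of the induction, and one more than
the digit of the image in the first case. -/
theorem floor_cases {p : ℝ × ℝ} (hp : p ∈ btTriangle) :
    (¬ p.1 ≤ 1 / 2 ∧ ⌊1 / p.1⌋₊ = 1) ∨
      (p.1 ≤ 1 / 2 ∧ ⌊1 / p.1⌋₊ = ⌊1 / (btInduction p).1⌋₊ + 1) := by
  obtain ⟨h1, h2, h3⟩ := hp
  have h0 : 0 < p.1 := h1.trans h2
  by_cases h : p.1 ≤ 1 / 2
  · refine .inr ⟨h, ?_⟩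
    have h4 : (1 : ℝ) ≤ 1 / p.1 := by rw [le_div_iff₀ h0]; linarith
    have h5 : 1 / (btInduction p).1 = 1 / p.1 - 1 := by
      simp only [btInduction, if_pos h]
      field_simp
    rw [h5, Nat.floor_sub_one]
    have : 1 ≤ ⌊1 / p.1⌋₊ := (Nat.le_floor_iff' one_ne_zero).2 (by simpa using h4)
    omega
  · refine .inl ⟨h, ?_⟩
    rw [Nat.floor_eq_iff (by positivity)]
    constructor
    · rw [le_div_iff₀ h0]; push_cast; linarith
    · rw [div_lt_iff₀ h0]; push_cast; linarith

theorem one_le_floor {p : ℝ × ℝ} (hp : p ∈ btTriangle) : 1 ≤ ⌊1 / p.1⌋₊ := by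
  rcases floor_cases hp with h | h <;> omega

/-- A digit `k` is read as `k - 1` first cases followed by one second case, which gives the block `U
^ (k - 1) * M 1 = M k`. -/
theorem cocycle_floor {M : ℕ → Matrix (Fin 3) (Fin 3) ℝ} {U : Matrix (Fin 3) (Fin 3) ℝ}
    (hM : ∀ k, U * M k = M (k + 1)) {p : ℝ × ℝ} (hp : p ∈ btRegular) :
    cocycle btInduction (btStep U (M 1)) ⌊1 / p.1⌋₊ p = M ⌊1 / p.1⌋₊ := by
  generalize hk : ⌊1 / p.1⌋₊ = k
  induction k generalizing p with
  | zero => exact absurd hk (Nat.one_le_iff_ne_zero.1 (one_le_floor (hp 0)))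
  | succ k ih =>
    rcases floor_cases (hp 0) with ⟨h1, h2⟩ | ⟨h1, h2⟩
    · rw [Function.iterate_zero_apply] at h1 h2
      obtain rfl : k = 0 := by omega
      rw [cocycle, cocycle, btStep, if_neg h1, mul_one]
    · rw [Function.iterate_zero_apply] at h1 h2
      rw [cocycle, ih (p := btInduction p) (iterate_mem_btRegular hp 1) (by omega)]
      rw [btStep, if_pos h1, hM]

theorem birkhoffSum_negVisit_floor {p : ℝ × ℝ} (hp : p ∈ btRegular) :
    birkhoffSum btInduction negVisit ⌊1 / p.1⌋₊ p = -1 := by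
  generalize hk : ⌊1 / p.1⌋₊ = k
  induction k generalizing p with
  | zero => exact absurd hk (Nat.one_le_iff_ne_zero.1 (one_le_floor (hp 0)))
  | succ k ih =>
    rcases floor_cases (hp 0) with ⟨h1, h2⟩ | ⟨h1, h2⟩
    · rw [Function.iterate_zero_apply] at h1 h2
      obtain rfl : k = 0 := by omega
      rw [zero_add, birkhoffSum_one, negVisit, if_neg h1]
    · rw [Function.iterate_zero_apply] at h1 h2
      rw [birkhoffSum_succ', ih (p := btInduction p) (iterate_mem_btRegular hp 1) (by omega)]
      rw [negVisit, if_pos h1, zero_add]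

/-! ### From slow time to digit time -/

/-- The number of steps of the induction that make up `n` steps of its acceleration. -/
noncomputable def digitTime (p : ℝ × ℝ) (n : ℕ) : ℕ := ∑ i ∈ Finset.range n, btDigit p i

theorem btGauss_iterate (p : ℝ × ℝ) (n : ℕ) : btGauss^[n] p = btInduction^[digitTime p n] p := by
  induction n with
  | zero => rfl
  | succ n ih =>
    rw [Function.iterate_succ_apply', digitTime, Finset.sum_range_succ, add_comm,
      Function.iterate_add_apply, ← digitTime, ← ih]
    rfl

theorem btGauss_iterate_mem {p : ℝ × ℝ} (hp : p ∈ btRegular) (n : ℕ) :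
    btGauss^[n] p ∈ btRegular := by
  rw [btGauss_iterate]
  exact iterate_mem_btRegular hp _

theorem one_le_btDigit {p : ℝ × ℝ} (hp : p ∈ btRegular) (n : ℕ) : 1 ≤ btDigit p n :=
  one_le_floor (btGauss_iterate_mem hp n 0)

theorem le_digitTime {p : ℝ × ℝ} (hp : p ∈ btRegular) (n : ℕ) : n ≤ digitTime p n := by
  simpa [digitTime] using Finset.card_nsmul_le_sum (Finset.range n) (btDigit p) 1
    fun i _ => one_le_btDigit hp i

theorem tendsto_digitTime {p : ℝ × ℝ} (hp : p ∈ btRegular) : Tendsto (digitTime p) atTop atTop :=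
  tendsto_atTop_mono (le_digitTime hp) tendsto_id

theorem cocycle_digitTime {M : ℕ → Matrix (Fin 3) (Fin 3) ℝ} {U : Matrix (Fin 3) (Fin 3) ℝ}
    (hM : ∀ k, U * M k = M (k + 1)) {p : ℝ × ℝ} (hp : p ∈ btRegular) (n : ℕ) :
    cocycle btInduction (btStep U (M 1)) (digitTime p n) p = matrixProduct M (btDigit p) n := by
  induction n with
  | zero => simp [digitTime, cocycle, matrixProduct_zero]
  | succ n ih =>
    rw [digitTime, Finset.sum_range_succ, cocycle_add, ← digitTime, ih, ← btGauss_iterate,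
      matrixProduct_succ, btDigit, cocycle_floor hM (btGauss_iterate_mem hp n)]

theorem birkhoffSum_negVisit_digitTime {p : ℝ × ℝ} (hp : p ∈ btRegular) (n : ℕ) :
    birkhoffSum btInduction negVisit (digitTime p n) p = -n := by
  induction n with
  | zero => simp [digitTime]
  | succ n ih =>
    rw [digitTime, Finset.sum_range_succ, birkhoffSum_add, ← digitTime, ih, ← btGauss_iterate,
      btDigit, birkhoffSum_negVisit_floor (btGauss_iterate_mem hp n)]
    push_cast
    ring

/-- The mean digit exists and is finite along almost every orbit. -/
theorem ae_tendsto_digitTime {μ : Measure (ℝ × ℝ)} (hμ : IsBTMeasure μ) :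
    ∀ᵐ p ∂μ, ∃ c : ℝ, 0 < c ∧ Tendsto (fun n : ℕ => (digitTime p n : ℝ) / n) atTop (𝓝 c) := by
  have := hμ.isProbabilityMeasure
  have h := isBoundedSubadditive_birkhoffSum_negVisit hμ.invariant.measurable
  filter_upwards [IsBoundedSubadditive.ae_tendsto hμ.invariant h,
    IsBoundedSubadditive.ae_upper_neg hμ.invariant h birkhoffSum_negVisit_nonpos,
    ae_btRegular hμ] with p h1 h2 hp
  -- The first digit block contains a second case, so the visit sum becomes negative on every
  -- regular orbit. Its rate is thus negative, and the mean digit is the inverse of a positive visit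
  -- frequency.
  have h3 := h2 ⟨_, (birkhoffSum_negVisit_floor hp).trans_lt (by norm_num)⟩
  set u := IsBoundedSubadditive.upper (birkhoffSum btInduction negVisit) p
  refine ⟨(-u)⁻¹, inv_pos.2 (neg_pos.2 h3), ?_⟩
  refine ((h1.comp (tendsto_digitTime hp)).neg.inv₀ (neg_pos.2 h3).ne').congr fun n => ?_
  simp [birkhoffSum_negVisit_digitTime hp, neg_div]

/-- The rate per digit is the slow rate, sampled at the ends of the digit blocks, times the mean
block length. -/
theorem tendsto_matrixProduct_of_cocycle {M : ℕ → Matrix (Fin 3) (Fin 3) ℝ}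
    {U : Matrix (Fin 3) (Fin 3) ℝ} (hM : ∀ k, U * M k = M (k + 1)) {p : ℝ × ℝ}
    (hp : p ∈ btRegular) {a c : ℝ}
    (hc : Tendsto (fun n : ℕ => (digitTime p n : ℝ) / n) atTop (𝓝 c))
    (ha : Tendsto (fun n : ℕ =>
      Real.log (rowNorm (cocycle btInduction (btStep U (M 1)) n p)) / n) atTop (𝓝 a)) :
    Tendsto (fun n : ℕ => Real.log (rowNorm (matrixProduct M (btDigit p) n)) / n) atTop
      (𝓝 (a * c)) := by
  refine ((ha.comp (tendsto_digitTime hp)).mul hc).congr' ?_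
  filter_upwards [eventually_ge_atTop 1] with n hn
  have h1 : (digitTime p n : ℝ) ≠ 0 := by
    have := le_digitTime hp n
    exact_mod_cast (by omega : digitTime p n ≠ 0)
  simp only [Function.comp_apply, cocycle_digitTime hM hp]
  field_simp

theorem rowExpanding_btStep {U C : Matrix (Fin 3) (Fin 3) ℝ} (hU : RowExpanding U)
    (hC : RowExpanding C) (p : ℝ × ℝ) : RowExpanding (btStep U C p) := by
  unfold btStep
  split_ifs <;> assumption

theorem rowNorm_btStep_le {U C : Matrix (Fin 3) (Fin 3) ℝ} {K : ℝ} (hU : rowNorm U ≤ K)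
    (hC : rowNorm C ≤ K) (p : ℝ × ℝ) : rowNorm (btStep U C p) ≤ K := by
  unfold btStep
  split_ifs <;> assumption

theorem rowExpanding_shearA : RowExpanding shearA := by
  constructor
  · intro i j
    fin_cases i <;> fin_cases j <;> simp [shearA]
  · intro i
    fin_cases i <;> simp [shearA, Fin.sum_univ_three]

theorem rowExpanding_shearL : RowExpanding shearL := by
  constructor
  · intro i j
    fin_cases i <;> fin_cases j <;> simp [shearL]
  · intro i
    fin_cases i <;> simp [shearL, Fin.sum_univ_three]

theorem lengthMatrix_one : lengthMatrix 1 = A₃ 1 := by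
  ext i j
  fin_cases i <;> fin_cases j <;> simp [lengthMatrix, A₃]

/-- The two shears differ in a single entry and the return matrices agree, so any strict gain comes
from first cases, that is, from digits exceeding `1`. -/
theorem btStep_shearA_le (p : ℝ × ℝ) (i j : Fin 3) :
    btStep shearA (A₃ 1) p i j ≤ btStep shearL (lengthMatrix 1) p i j := by
  unfold btStep
  split_ifs
  · fin_cases i <;> fin_cases j <;> simp [shearA, shearL]
  · rw [lengthMatrix_one]

theorem rowNorm_le_three {M : Matrix (Fin 3) (Fin 3) ℝ} (h : ∀ i j, |M i j| ≤ 1) :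
    rowNorm M ≤ 3 := by
  simpa using rowNorm_le_three_mul h

theorem rowNorm_shearA_le : rowNorm shearA ≤ 3 := by
  refine rowNorm_le_three fun i j => ?_
  fin_cases i <;> fin_cases j <;> simp [shearA]

theorem rowNorm_shearL_le : rowNorm shearL ≤ 3 := by
  refine rowNorm_le_three fun i j => ?_
  fin_cases i <;> fin_cases j <;> simp [shearL]

theorem rowNorm_A₃_one_le : rowNorm (A₃ 1) ≤ 3 := by
  refine rowNorm_le_three fun i j => ?_
  fin_cases i <;> fin_cases j <;> simp [A₃]

theorem exists_one_lt_of_frequently {k : ℕ → ℕ} (h0 : ∃ᶠ i in atTop, 1 < k (2 * i))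
    (h1 : ∃ᶠ j in atTop, 1 < k (2 * j + 1)) (n : ℕ) : ∃ t, 1 < k (n + 2 * t) := by
  obtain ⟨m, rfl | rfl⟩ := n.even_or_odd'
  · obtain ⟨i, hi, h⟩ := frequently_atTop.1 h0 m
    refine ⟨i - m, ?_⟩
    rwa [show 2 * m + 2 * (i - m) = 2 * i by omega]
  · obtain ⟨i, hi, h⟩ := frequently_atTop.1 h1 m
    refine ⟨i - m, ?_⟩
    rwa [show 2 * m + 1 + 2 * (i - m) = 2 * i + 1 by omega]

end Acceleration

theorem mainTheorem4 (μ : Measure (ℝ × ℝ)) (hμ : IsBTMeasure μ) :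
    ∀ᵐ p ∂μ,
      (∃ᶠ i in atTop, 1 < btDigit p (2 * i)) → (∃ᶠ j in atTop, 1 < btDigit p (2 * j + 1)) →
      ∃ l m : Fin 3 → ℝ,
        HasLyapunovExponents (matrixProduct A₃ (btDigit p)) l ∧
        HasLyapunovExponents (matrixProduct B₃ (btDigit p)) m ∧
        0 < l 0 ∧ 0 < l 1 ∧ l 2 < 0 ∧ l 0 < m 0 := by
  have := hμ.isProbabilityMeasure
  have hA := rowExpanding_btStep rowExpanding_shearA (rowExpanding_A₃ le_rfl)
  have hL := rowExpanding_btStep rowExpanding_shearL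
    (lengthMatrix_one ▸ rowExpanding_A₃ le_rfl : RowExpanding (lengthMatrix 1))
  filter_upwards [ae_btRegular hμ, ae_tendsto_digitTime hμ,
    ae_exists_growth_lt hμ.invariant (measurable_btStep _ _) (measurable_btStep _ _) hA hL
      btStep_shearA_le three_pos (rowNorm_btStep_le rowNorm_shearA_le rowNorm_A₃_one_le)
      (rowNorm_btStep_le rowNorm_shearL_le (lengthMatrix_one ▸ rowNorm_A₃_one_le))]
    with p hp ⟨c, hc0, hc⟩ ⟨a, b, ha, hb, hab⟩ h0 h1
  obtain ⟨n, hn⟩ := exists_matrixProduct_A₃_lt (one_le_btDigit hp)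
    (exists_one_lt_of_frequently h0 h1)
  have hlt : a < b := hab ⟨digitTime p n, fun i j => by
    rw [cocycle_digitTime shearA_mul hp, cocycle_digitTime shearL_mul hp]
    exact hn i j⟩
  have hlt' : a * c < b * c := mul_lt_mul_of_pos_right hlt hc0
  obtain ⟨hlA, hlB, hle⟩ := hasLyapunovExponents_A₃_B₃
    (tendsto_matrixProduct_of_cocycle shearA_mul hp hc ha)
    (tendsto_matrixProduct_of_cocycle shearL_mul hp hc hb)
  -- Only `hlt'` and the ordering `hle` are needed: `b * c - a * c` is positive and at most `a * c`,
  -- so `a * c` and `b * c` are positive.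
  refine ⟨_, _, hlA, hlB, ?_, ?_, ?_, ?_⟩ <;> simp <;> linarith
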